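/- Let $d\ge 3$ and $k\ge 4$ be integers and let $\beta_k\in(0,1)$. Put $N_{k,d}=\binom{d+k-1}{d-1}-\binom{d+k-3}{d-1}$ (the dimension of the space of degree-$k$ spherical harmonics on the unit sphere $\mathbb S^{d-1}\subset\mathbb R^d$), and let $P_{k,d}$ be the degree-$k$ Legendre polynomial in dimension $d$, given by $P_{0,d}(t)=1$, $P_{1,d}(t)=t$ and $P_{j,d}(t)=\frac{2j+d-4}{j+d-3}\,t\,P_{j-1,d}(t)-\frac{j-1}{j+d-3}\,P_{j-2,d}(t)$ for $j\ge 2$. Consider the hypothesis class $\mathcal F_k=\{\beta_kP_{k,d}(\langle\cdot,u\rangle):u\in\mathbb S^{d-1}\}$ of functions on $\mathbb S^{d-1}$. Fix any (possibly randomized and adaptive) algorithm that in round $i=1,\dots,n$ chooses a point $x_i\in\mathbb S^{d-1}$, depending on its internal randomness and on the earlier rounds, observes $y_i=f(x_i)+\varepsilon_i$ with independent noise $\varepsilon_i\sim\mathcal N(0,1)$, where $f$ is the ground truth, and after $n$ rounds outputs a function $\hat f:\mathbb S^{d-1}\to\mathbb R$. Let $E_{f,n}$ be the probability, when the ground truth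 is $f$, that $\|\hat f-f\|_\infty=\sup_{x\in\mathbb S^{d-1}}|\hat f(x)-f(x)|\le\beta_k/4$. If $n<N_{k,d}\,\beta_k^{-2}$, then there is some $f\in\mathcal F_k$ with $E_{f,n}\le 1/2$; that is, $\min_{f\in\mathcal F_k}E_{f,n}\le 1/2$. -/

import Mathlib

open MeasureTheory ProbabilityTheory
open scoped ENNReal

noncomputable section

/-- The unit sphere `S^{d-1}` of `ℝ^d`. -/
abbrev UnitSphere (d : ℕ) : Type := Metric.sphere (0 : EuclideanSpace ℝ (Fin d)) 1

/-- The dimension `N_{k,d}` of the space of degree-`k` spherical harmonics on `S^{d-1}`.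
For `d ≥ 2` the second binomial coefficient never exceeds the first one, so that the
subtraction of natural numbers is the true one. -/
def harmonicDim (k d : ℕ) : ℕ :=
  (d + k - 1).choose (d - 1) - (d + k - 3).choose (d - 1)

/-- The degree-`k` Legendre polynomial `P_{k,d}` in dimension `d`, as a function on `ℝ`:
`P_{0,d}(t) = 1`, `P_{1,d}(t) = t` and, for `k ≥ 2`,
`P_{k,d}(t) = (2k+d-4)/(k+d-3) t P_{k-1,d}(t) - (k-1)/(k+d-3) P_{k-2,d}(t)`. -/
def legendreP (d : ℕ) : ℕ → ℝ → ℝ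
  | 0, _ => 1
  | 1, t => t
  | (j + 2), t =>
      (2 * ((j : ℝ) + 2) + d - 4) / (((j : ℝ) + 2) + d - 3) * t * legendreP d (j + 1) t
        - (((j : ℝ) + 2) - 1) / (((j : ℝ) + 2) + d - 3) * legendreP d j t

/-- The function `x ↦ β P_{k,d}(⟨x, u⟩)` on the sphere. -/
def ridge (k d : ℕ) (β : ℝ) (u x : UnitSphere d) : ℝ :=
  β * legendreP d k (inner ℝ (x : EuclideanSpace ℝ (Fin d)) (u : EuclideanSpace ℝ (Fin d)))

/-- The hypothesis class `{β P_{k,d}(⟨·, u⟩) : u ∈ S^{d-1}}`. -/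
def hypothesisClass (k d : ℕ) (β : ℝ) : Set (UnitSphere d → ℝ) :=
  {f | ∃ u : UnitSphere d, f = ridge k d β u}

/-- The distance `‖g - f‖_∞ = sup_x |g x - f x|` over the sphere. It is a supremum of absolute
values, not an essential one, and it is infinite if the difference is unbounded. -/
def supDist {d : ℕ} (g f : UnitSphere d → ℝ) : ℝ≥0∞ :=
  ⨆ x : UnitSphere d, ‖g x - f x‖ₑ

/-- A (possibly randomized) adaptive algorithm that makes `n` noisy queries to an unknown function
on `S^{d-1}`. It draws an internal random seed `ω : Ω`. Its query point in round `i`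
(rounds are numbered from `0`) is a measurable function of the seed and of the responses
`y_0, …, y_{i-1}` to the earlier queries; only the rounds `i < n` are ever used. After `n` rounds
it outputs a real function on the sphere, each value of which is a random variable. As the earlier
query points are themselves determined by the seed and the responses, they need not be recorded. -/
structure QueryAlgorithm (d n : ℕ) (Ω : Type*) [MeasurableSpace Ω] where
  query : (i : ℕ) → Ω → (Fin i → ℝ) → UnitSphere d
  measurable_query : ∀ i : ℕ,
    Measurable (fun p : Ω × (Fin i → ℝ) => query i p.1 p.2)
  output : Ω → (Fin n → ℝ) → UnitSphere d → ℝ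
  measurable_output : ∀ x : UnitSphere d,
    Measurable (fun p : Ω × (Fin n → ℝ) => output p.1 p.2 x)

namespace QueryAlgorithm

variable {d n : ℕ} {Ω : Type*} [MeasurableSpace Ω]

/-- The responses `y_0, …, y_{m-1}` of the first `m` rounds when the ground truth is `f`, the seed
is `ω` and the noise is `ε`: `y_i = f(x_i) + ε_i`, where `x_i` is the point queried in
round `i` after seeing `y_0, …, y_{i-1}`. -/
def responses (A : QueryAlgorithm d n Ω) (f : UnitSphere d → ℝ) (ω : Ω) :
    (m : ℕ) → (Fin m → ℝ) → (Fin m → ℝ)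
  | 0, _ => Fin.elim0
  | (m + 1), ε =>
      Fin.snoc (α := fun _ => ℝ) (A.responses f ω m (Fin.init ε))
        (f (A.query m ω (A.responses f ω m (Fin.init ε))) + ε (Fin.last m))

/-- The probability that the output `f̂` of the algorithm satisfies `‖f̂ - f‖_∞ ≤ r` after `n`
queries with ground truth `f`, where the seed has law `μ` and the noise consists of `n`
independent standard Gaussians that are independent of the seed. -/
def successProb (A : QueryAlgorithm d n Ω) (μ : Measure Ω) (f : UnitSphere d → ℝ) (r : ℝ) :
    ℝ≥0∞ :=
  (μ.prod (Measure.pi (fun _ : Fin n => gaussianReal 0 1)))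
    {p | supDist (A.output p.1 (A.responses f p.1 n p.2)) f ≤ ENNReal.ofReal r}

end QueryAlgorithm

end

/-! Draw the centre `u` uniformly and compare two laws of (centre, seed, responses): pure noise,
where the responses carry no information about `u`, and the true law with ground truth `ridge k d β
u`. If every success probability exceeded 1/2, the event `closeOn` (output within `β / 4` of the
ridge function) would have true probability at least 1/2.

Under pure noise the queries are independent of `u`, so each round has mean energy `β ^ 2 / N` with
`N = harmonicDim k d`, because a degree-`k` Legendre polynomial has mean square `1 / N` under the
law of a coordinate. The relative entropy of pure noise with respect to the true law is thus `n * β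
^ 2 / (2 * N) < 1 / 2`. The variational inequality `integral_log_le_log_integral_responses`
expresses this without densities on the response space.

Under pure noise the event has probability at most 6/125. Two centres that fit the same output have
ridge functions within `β / 2` of each other. Evaluating these at one centre and at a reflected
point confines the inner product of the centres to a set that `measureReal_close_le` bounds: by
Chebyshev for large `N`, by explicit estimates in the remaining dimensions 3, 4 and 5. A two-valued
test function then gives a contradiction, by the narrow numerical margin of
`half_le_log_combination`. -/

/-! ### Entropy inequalities for one Gaussian observation. -/

lemma integrable_of_mem_Icc {X : Type*} [MeasurableSpace X] {ν : Measure X} [IsFiniteMeasure ν]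
    {φ : X → ℝ} (hφ : Measurable φ) {a b : ℝ} (hab : ∀ e, φ e ∈ Set.Icc a b) :
    Integrable φ ν :=
  .of_mem_Icc a b hφ.aemeasurable (.of_forall hab)

lemma integrable_log_of_mem_Icc {X : Type*} [MeasurableSpace X] {ν : Measure X}
    [IsFiniteMeasure ν] {φ : X → ℝ} (hφ : Measurable φ) {a b : ℝ} (ha : 0 < a)
    (hab : ∀ e, φ e ∈ Set.Icc a b) : Integrable (fun e => Real.log (φ e)) ν :=
  integrable_of_mem_Icc (a := Real.log a) (b := Real.log b) (Real.measurable_log.comp hφ)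
    fun e => ⟨Real.log_le_log ha (hab e).1, Real.log_le_log (ha.trans_le (hab e).1) (hab e).2⟩

lemma integral_mem_Icc {X : Type*} [MeasurableSpace X] {ν : Measure X} [IsProbabilityMeasure ν]
    {φ : X → ℝ} (hφ : Measurable φ) {a b : ℝ} (hab : ∀ e, φ e ∈ Set.Icc a b) :
    ∫ e, φ e ∂ν ∈ Set.Icc a b := by
  have hi := integrable_of_mem_Icc (ν := ν) hφ hab
  constructor
  · simpa using integral_mono (integrable_const a) hi fun e => (hab e).1
  · simpa using integral_mono hi (integrable_const b) fun e => (hab e).2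

/-- The tangent line of `log` at `A`. Integrated with `A` the mean, it gives both Jensen's
inequality and the shift bound below. -/
lemma log_le_div_sub_one_add_log {x A : ℝ} (hx : 0 < x) (hA : 0 < A) :
    Real.log x ≤ x / A - 1 + Real.log A := by
  have h := Real.log_le_sub_one_of_pos (div_pos hx hA)
  rw [Real.log_div hx.ne' hA.ne'] at h
  linarith

lemma integral_log_le_log_integral {X : Type*} [MeasurableSpace X] (ν : Measure X)
    [IsProbabilityMeasure ν] {φ : X → ℝ} (hφ : Measurable φ) {a b : ℝ} (ha : 0 < a)
    (hab : ∀ e, φ e ∈ Set.Icc a b) :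
    ∫ e, Real.log (φ e) ∂ν ≤ Real.log (∫ e, φ e ∂ν) := by
  set A := ∫ e, φ e ∂ν with hAdef
  have hA : 0 < A := ha.trans_le (integral_mem_Icc hφ hab).1
  have hi := integrable_of_mem_Icc (ν := ν) hφ hab
  have h := integral_mono (integrable_log_of_mem_Icc (ν := ν) hφ ha hab)
    (((hi.div_const A).sub (integrable_const 1)).add (integrable_const (Real.log A)))
    (fun e => log_le_div_sub_one_add_log (ha.trans_le (hab e).1) hA)
  refine h.trans (le_of_eq ?_)
  simp only [Pi.add_apply, Pi.sub_apply]
  rw [integral_add (f := fun e => φ e / A - 1) ((hi.div_const A).sub (integrable_const 1))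
      (integrable_const _),
    integral_sub (hi.div_const A) (integrable_const 1), integral_div, ← hAdef]
  simp [div_self hA.ne']

/-- Change of variables for a shifted standard Gaussian. -/
lemma integral_const_add_gaussianReal (φ : ℝ → ℝ) (c : ℝ) :
    ∫ e, φ (c + e) ∂gaussianReal 0 1
      = ∫ e, φ e * Real.exp (c * e - c ^ 2 / 2) ∂gaussianReal 0 1 := by
  have h1 : ∫ e, φ (c + e) ∂gaussianReal 0 1 = ∫ e, φ e ∂gaussianReal c 1 := by
    have h := gaussianReal_map_const_add (μ := 0) (v := 1) c
    rw [zero_add] at h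
    rw [← h, (measurableEmbedding_addLeft c).integral_map]
  rw [h1, integral_gaussianReal_eq_integral_smul one_ne_zero,
    integral_gaussianReal_eq_integral_smul one_ne_zero]
  refine integral_congr_ae (.of_forall fun e => ?_)
  simp only [gaussianPDFReal, smul_eq_mul, NNReal.coe_one, mul_one, sub_zero]
  rw [mul_comm (φ e), ← mul_assoc, mul_assoc _ (Real.exp _) (Real.exp _), ← Real.exp_add]
  congr 3
  ring

/-- A variational bound for the shift of a standard Gaussian. -/
lemma integral_log_gaussianReal_le {φ : ℝ → ℝ} (hφ : Measurable φ) {a b : ℝ} (ha : 0 < a)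
    (hab : ∀ e, φ e ∈ Set.Icc a b) (c : ℝ) :
    ∫ e, Real.log (φ e) ∂gaussianReal 0 1
      ≤ Real.log (∫ e, φ (c + e) ∂gaussianReal 0 1) + c ^ 2 / 2 := by
  set γ := gaussianReal 0 1
  set A := ∫ e, φ (c + e) ∂γ with hAdef
  have hA : 0 < A := ha.trans_le
    (integral_mem_Icc (hφ.comp (measurable_const_add c)) fun e => hab (c + e)).1
  have hAe : A = ∫ e, φ e * Real.exp (c * e - c ^ 2 / 2) ∂γ :=
    integral_const_add_gaussianReal φ c
  have hid : Integrable (fun e : ℝ => e) γ :=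
    (memLp_id_gaussianReal' 1 ENNReal.one_ne_top).integrable le_rfl
  have hexp : Integrable (fun e => Real.exp (c * e - c ^ 2 / 2)) γ := by
    simp_rw [Real.exp_sub]
    exact (integrable_exp_mul_gaussianReal c).div_const _
  have hprod : Integrable (fun e => φ e * Real.exp (c * e - c ^ 2 / 2)) γ := by
    refine hexp.bdd_mul (c := max |a| |b|) hφ.aestronglyMeasurable (.of_forall fun e => ?_)
    exact abs_le_max_abs_abs (hab e).1 (hab e).2
  have hlog := integrable_log_of_mem_Icc (ν := γ) hφ ha hab
  -- The tangent line is applied to `φ` times the density of the shift. The mean of the product is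
  -- `A`, and the log-density has mean `-c ^ 2 / 2`.
  have h := integral_mono (hlog.add ((hid.const_mul c).sub (integrable_const (c ^ 2 / 2))))
    (((hprod.div_const A).sub (integrable_const 1)).add (integrable_const (Real.log A)))
    (fun e => by
      have hpos := ha.trans_le (hab e).1
      have h := log_le_div_sub_one_add_log (mul_pos hpos (Real.exp_pos (c * e - c ^ 2 / 2))) hA
      rwa [Real.log_mul hpos.ne' (Real.exp_pos _).ne', Real.log_exp] at h)
  simp only [Pi.add_apply, Pi.sub_apply] at h
  rw [integral_add (g := fun e => c * e - c ^ 2 / 2) hlog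
      ((hid.const_mul c).sub (integrable_const _)),
    integral_sub (hid.const_mul c) (integrable_const _), integral_const_mul,
    integral_add (f := fun e => φ e * Real.exp (c * e - c ^ 2 / 2) / A - 1)
      ((hprod.div_const A).sub (integrable_const 1)) (integrable_const _),
    integral_sub (hprod.div_const A) (integrable_const 1),
    integral_div A (fun e => φ e * Real.exp (c * e - c ^ 2 / 2)), ← hAe] at h
  have h0 : ∫ e, e ∂γ = 0 := integral_id_gaussianReal
  rw [h0, div_self hA.ne'] at h
  simp only [integral_const, probReal_univ, smul_eq_mul, one_mul, mul_zero] at h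
  linarith

lemma measurePreserving_snoc (ν : Measure ℝ) [SigmaFinite ν] (m : ℕ) :
    MeasurePreserving (fun p : (Fin m → ℝ) × ℝ => (Fin.snoc p.1 p.2 : Fin (m + 1) → ℝ))
      ((Measure.pi fun _ : Fin m => ν).prod ν) (Measure.pi fun _ : Fin (m + 1) => ν) := by
  have h := (measurePreserving_piFinSuccAbove (fun _ : Fin (m + 1) => ν) (Fin.last m)).symm
  have h2 := h.comp (Measure.measurePreserving_swap
    (μ := Measure.pi fun _ : Fin m => ν) (ν := ν))
  convert! h2 using 1
  ext p i
  simp [MeasurableEquiv.piFinSuccAbove, Fin.insertNthEquiv]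

lemma measurable_snoc_comp {X : Type*} [MeasurableSpace X] {m : ℕ} {f : X → Fin m → ℝ}
    {g : X → ℝ} (hf : Measurable f) (hg : Measurable g) :
    Measurable fun x => (Fin.snoc (f x) (g x) : Fin (m + 1) → ℝ) :=
  (measurePreserving_snoc (gaussianReal 0 1) m).measurable.comp (hf.prodMk hg)

/-- Integration over `m + 1` coordinates, the last one first. -/
lemma integral_prod_pi_snoc {Θ : Type*} [MeasurableSpace Θ] (ρ : Measure Θ)
    [IsProbabilityMeasure ρ] (ν : Measure ℝ) [IsProbabilityMeasure ν] {m : ℕ}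
    {φ : Θ × (Fin (m + 1) → ℝ) → ℝ}
    (hφ : Integrable φ (ρ.prod (Measure.pi fun _ : Fin (m + 1) => ν))) :
    ∫ p, φ p ∂ρ.prod (Measure.pi fun _ : Fin (m + 1) => ν)
      = ∫ p : Θ × (Fin m → ℝ), ∫ e, φ (p.1, Fin.snoc p.2 e) ∂ν
          ∂ρ.prod (Measure.pi fun _ : Fin m => ν) := by
  have h := ((MeasurePreserving.id ρ).prod (measurePreserving_snoc ν m)).comp
    (measurePreserving_prodAssoc ρ (Measure.pi fun _ : Fin m => ν) ν)
  rw [← h.map_eq, integral_map h.measurable.aemeasurable (by rw [h.map_eq]; exact hφ.1)]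
  rw [integral_prod]
  · rfl
  · exact h.integrable_comp_of_integrable hφ

/-! ### The entropy bound for adaptive queries. -/

namespace QueryAlgorithm

variable {d n : ℕ} {Ω U : Type*} [MeasurableSpace Ω] [MeasurableSpace U]

lemma measurable_responses (A : QueryAlgorithm d n Ω) {F : U → UnitSphere d → ℝ}
    (hF : Measurable (Function.uncurry F)) (m : ℕ) :
    Measurable (fun p : (U × Ω) × (Fin m → ℝ) => A.responses (F p.1.1) p.1.2 m p.2) := by
  induction m with
  | zero => exact measurable_const
  | succ m ih =>
    have hinit : Measurable (fun p : (U × Ω) × (Fin (m + 1) → ℝ) => (p.1, Fin.init p.2)) :=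
      measurable_fst.prodMk (measurable_pi_lambda _ fun i =>
        (measurable_pi_apply (Fin.castSucc i)).comp measurable_snd)
    have hR := ih.comp hinit
    refine measurable_snoc_comp hR (Measurable.add ?_ ?_)
    · exact hF.comp (measurable_fst.fst.prodMk
        ((A.measurable_query m).comp (measurable_fst.snd.prodMk hR)))
    · exact (measurable_pi_apply (Fin.last m)).comp measurable_snd

lemma measurable_drift (A : QueryAlgorithm d n Ω) {F : U → UnitSphere d → ℝ}
    (hF : Measurable (Function.uncurry F)) (m : ℕ) :
    Measurable (fun p : (U × Ω) × (Fin m → ℝ) => F p.1.1 (A.query m p.1.2 p.2)) :=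
  hF.comp (measurable_fst.fst.prodMk
    ((A.measurable_query m).comp (measurable_fst.snd.prodMk measurable_snd)))

lemma responses_snoc (A : QueryAlgorithm d n Ω) (f : UnitSphere d → ℝ) (ω : Ω) {m : ℕ}
    (ε : Fin m → ℝ) (e : ℝ) :
    A.responses f ω (m + 1) (Fin.snoc ε e)
      = Fin.snoc (A.responses f ω m ε) (f (A.query m ω (A.responses f ω m ε)) + e) := by
  simp [responses]

/-- An upper bound for the mean of `log φ` under pure noise by the mean of `φ` under the responses
to a random ground truth, in terms of the mean energy of the observed values. -/
theorem integral_log_le_log_integral_responses (A : QueryAlgorithm d n Ω)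
    {F : U → UnitSphere d → ℝ} (hF : Measurable (Function.uncurry F)) {M : ℝ}
    (hM : ∀ u x, |F u x| ≤ M) (ρ : Measure (U × Ω)) [IsProbabilityMeasure ρ] (m : ℕ)
    {φ : (U × Ω) × (Fin m → ℝ) → ℝ} (hφ : Measurable φ) {a b : ℝ} (ha : 0 < a)
    (hab : ∀ p, φ p ∈ Set.Icc a b) :
    ∫ p, Real.log (φ p) ∂ρ.prod (Measure.pi fun _ : Fin m => gaussianReal 0 1)
      ≤ Real.log (∫ p, φ (p.1, A.responses (F p.1.1) p.1.2 m p.2)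
          ∂ρ.prod (Measure.pi fun _ : Fin m => gaussianReal 0 1))
        + (∑ i ∈ Finset.range m, ∫ p : (U × Ω) × (Fin i → ℝ), (F p.1.1 (A.query i p.1.2 p.2)) ^ 2
          ∂ρ.prod (Measure.pi fun _ : Fin i => gaussianReal 0 1)) / 2 := by
  induction m with
  | zero =>
    have : ∀ p : (U × Ω) × (Fin 0 → ℝ), (p.1, A.responses (F p.1.1) p.1.2 0 p.2) = p :=
      fun p => Prod.ext rfl (Subsingleton.elim _ _)
    simp only [this, Finset.range_zero, Finset.sum_empty, zero_div, add_zero]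
    exact integral_log_le_log_integral _ hφ ha hab
  | succ m ih =>
    set γ := gaussianReal 0 1
    set c : (U × Ω) × (Fin m → ℝ) → ℝ := fun p => F p.1.1 (A.query m p.1.2 p.2) with hc
    have hcm : Measurable c := A.measurable_drift hF m
    have hsn : Measurable (fun q : ((U × Ω) × (Fin m → ℝ)) × ℝ =>
        ((q.1.1, Fin.snoc q.1.2 (c q.1 + q.2)) : (U × Ω) × (Fin (m + 1) → ℝ))) :=
      measurable_fst.fst.prodMk (measurable_snoc_comp measurable_fst.snd
        ((hcm.comp measurable_fst).add measurable_snd))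
    -- The mean of `φ` over the last true response, given the earlier ones. It is again measurable
    -- with values in `[a, b]`, so the induction hypothesis applies to it.
    set H : (U × Ω) × (Fin m → ℝ) → ℝ :=
      fun p => ∫ e, φ (p.1, Fin.snoc p.2 (c p + e)) ∂γ with hH
    have hHm : Measurable H :=
      ((hφ.comp hsn).stronglyMeasurable.integral_prod_right' (ν := γ)).measurable
    have hHab : ∀ p, H p ∈ Set.Icc a b := fun p =>
      integral_mem_Icc (hφ.comp (hsn.comp measurable_prodMk_left)) fun e => hab _
    have hci : Integrable (fun p => c p ^ 2 / 2)
        (ρ.prod (Measure.pi fun _ : Fin m => γ)) := by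
      refine integrable_of_mem_Icc (a := 0) (b := M ^ 2 / 2) ((hcm.pow_const 2).div_const 2)
        fun p => ⟨by positivity, ?_⟩
      have := sq_le_sq' (neg_le_of_abs_le (hM p.1.1 (A.query m p.1.2 p.2)))
        (le_of_abs_le (hM p.1.1 (A.query m p.1.2 p.2)))
      simp only [hc]; linarith
    have hlogsn : Measurable (fun q : ((U × Ω) × (Fin m → ℝ)) × ℝ =>
        Real.log (φ (q.1.1, Fin.snoc q.1.2 q.2))) :=
      Real.measurable_log.comp (hφ.comp (measurable_fst.fst.prodMk
        (measurable_snoc_comp measurable_fst.snd measurable_snd)))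
    rw [integral_prod_pi_snoc ρ γ (integrable_log_of_mem_Icc hφ ha hab)]
    have hstep : ∫ p : (U × Ω) × (Fin m → ℝ), ∫ e, Real.log (φ (p.1, Fin.snoc p.2 e)) ∂γ
          ∂ρ.prod (Measure.pi fun _ : Fin m => γ)
        ≤ ∫ p, (Real.log (H p) + c p ^ 2 / 2) ∂ρ.prod (Measure.pi fun _ : Fin m => γ) := by
      refine integral_mono ?_ ((integrable_log_of_mem_Icc hHm ha hHab).add hci) fun p => ?_
      · refine integrable_of_mem_Icc (a := Real.log a) (b := Real.log b)
          (hlogsn.stronglyMeasurable.integral_prod_right' (ν := γ)).measurable fun p => ?_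
        refine integral_mem_Icc (hlogsn.comp measurable_prodMk_left) fun e => ?_
        exact ⟨Real.log_le_log ha (hab _).1,
          Real.log_le_log (ha.trans_le (hab _).1) (hab _).2⟩
      · refine integral_log_gaussianReal_le (φ := fun e => φ (p.1, Fin.snoc p.2 e))
          (hφ.comp ?_) ha (fun e => hab _) (c p)
        exact measurable_const.prodMk (measurable_snoc_comp measurable_const measurable_id)
    refine hstep.trans ?_
    rw [integral_add (integrable_log_of_mem_Icc hHm ha hHab) hci, integral_div,
      Finset.sum_range_succ, add_div]
    have hR := A.measurable_responses hF (m + 1)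
    have hlast : ∫ p, φ (p.1, A.responses (F p.1.1) p.1.2 (m + 1) p.2)
          ∂ρ.prod (Measure.pi fun _ : Fin (m + 1) => γ)
        = ∫ p, H (p.1, A.responses (F p.1.1) p.1.2 m p.2)
          ∂ρ.prod (Measure.pi fun _ : Fin m => γ) := by
      rw [integral_prod_pi_snoc ρ γ
        (φ := fun p => φ (p.1, A.responses (F p.1.1) p.1.2 (m + 1) p.2))
        (integrable_of_mem_Icc (hφ.comp (measurable_fst.prodMk hR)) fun p => hab _)]
      simp only [responses_snoc, hH, hc]
    rw [hlast]
    have := ih hHm hHab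
    linarith

end QueryAlgorithm

/-! ### Moments of a sphere coordinate, computed from Gaussian integrals. -/

lemma integral_Ioi_pow_mul_exp_neg_sq (a : ℕ) :
    ∫ r in Set.Ioi (0 : ℝ), r ^ a * Real.exp (-r ^ 2) = 1 / 2 * Real.Gamma ((a + 1) / 2) := by
  rw [← integral_rpow_mul_exp_neg_rpow (p := 2) (q := a) (by norm_num)
    (by linarith [Nat.cast_nonneg (α := ℝ) a])]
  refine setIntegral_congr_fun measurableSet_Ioi fun r _ => ?_
  norm_num [Real.rpow_natCast]

lemma integrableOn_Ioi_pow_mul_exp_neg_sq (a : ℕ) :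
    IntegrableOn (fun r : ℝ => r ^ a * Real.exp (-r ^ 2)) (Set.Ioi 0) := by
  have h := integrableOn_rpow_mul_exp_neg_rpow (p := 2) (s := a)
    (by linarith [Nat.cast_nonneg (α := ℝ) a]) (by norm_num)
  refine h.congr_fun (fun r _ => ?_) measurableSet_Ioi
  norm_num [Real.rpow_natCast]

lemma integral_Ioi_pow_mul_exp_neg_sq_succ (a : ℕ) :
    ∫ r in Set.Ioi (0 : ℝ), r ^ (a + 2) * Real.exp (-r ^ 2)
      = (a + 1) / 2 * ∫ r in Set.Ioi (0 : ℝ), r ^ a * Real.exp (-r ^ 2) := by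
  rw [integral_Ioi_pow_mul_exp_neg_sq, integral_Ioi_pow_mul_exp_neg_sq]
  have : ((a + 2 : ℕ) + 1 : ℝ) / 2 = (a + 1) / 2 + 1 := by push_cast; ring
  rw [this, Real.Gamma_add_one (by positivity)]
  ring

lemma integral_Ioi_pow_mul_exp_neg_sq_pos (a : ℕ) :
    0 < ∫ r in Set.Ioi (0 : ℝ), r ^ a * Real.exp (-r ^ 2) := by
  rw [integral_Ioi_pow_mul_exp_neg_sq]
  have := Real.Gamma_pos_of_pos (s := ((a : ℝ) + 1) / 2) (by positivity)
  positivity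

section Gaussian

variable {d : ℕ}

lemma integrable_inner_pow_mul_exp (hd : 0 < d) (x : EuclideanSpace ℝ (Fin d)) (hx : ‖x‖ = 1)
    (j : ℕ) :
    Integrable (fun y : EuclideanSpace ℝ (Fin d) => (inner ℝ x y) ^ j * Real.exp (-‖y‖ ^ 2)) := by
  have : Nonempty (Fin d) := ⟨⟨0, hd⟩⟩
  have h : Integrable (fun y : EuclideanSpace ℝ (Fin d) =>
      ‖y‖ ^ j * Real.exp (-‖y‖ ^ 2)) := by
    rw [integrable_fun_norm_addHaar volume (f := fun r : ℝ => r ^ j * Real.exp (-r ^ 2))]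
    refine (integrableOn_Ioi_pow_mul_exp_neg_sq
      (Module.finrank ℝ (EuclideanSpace ℝ (Fin d)) - 1 + j)).congr_fun (fun r _ => ?_)
      measurableSet_Ioi
    simp only [smul_eq_mul, pow_add]
    ring
  refine h.mono (by fun_prop) (.of_forall fun y => ?_)
  rw [norm_mul, norm_mul, norm_pow, norm_pow, norm_norm]
  have h1 := norm_inner_le_norm (𝕜 := ℝ) x y
  rw [hx, one_mul] at h1
  gcongr

/-- Integration by parts along `x`: the derivative of the Gaussian weight supplies the extra factor
`-2 * inner ℝ x y`. -/
lemma integral_inner_pow_mul_exp_succ (hd : 0 < d) (x : EuclideanSpace ℝ (Fin d)) (hx : ‖x‖ = 1)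
    (j : ℕ) :
    ∫ y : EuclideanSpace ℝ (Fin d), (inner ℝ x y) ^ (j + 2) * Real.exp (-‖y‖ ^ 2)
      = (j + 1) / 2 * ∫ y : EuclideanSpace ℝ (Fin d),
          (inner ℝ x y) ^ j * Real.exp (-‖y‖ ^ 2) := by
  have hd1 : ∀ y : EuclideanSpace ℝ (Fin d), HasLineDerivAt ℝ (fun y : EuclideanSpace ℝ (Fin d) =>
      (inner ℝ x y) ^ (j + 1)) ((j + 1) * (inner ℝ x y) ^ j) y x := by
    intro y
    have h := ((innerSL ℝ x).hasFDerivAt (x := y)).pow (j + 1)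
    convert! h.hasLineDerivAt x using 1
    simp [hx]
  have hd2 : ∀ y : EuclideanSpace ℝ (Fin d), HasLineDerivAt ℝ (fun y : EuclideanSpace ℝ (Fin d) =>
      Real.exp (-‖y‖ ^ 2)) (-2 * inner ℝ x y * Real.exp (-‖y‖ ^ 2)) y x := by
    intro y
    have h := ((hasStrictFDerivAt_norm_sq y).hasFDerivAt.neg).exp
    convert! h.hasLineDerivAt x using 1
    simp [real_inner_comm x y]
    ring
  have key := integral_bilinear_hasLineDerivAt_right_eq_neg_left_of_integrable
    (μ := (volume : Measure (EuclideanSpace ℝ (Fin d)))) (B := ContinuousLinearMap.mul ℝ ℝ)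
    (f := fun y : EuclideanSpace ℝ (Fin d) => (inner ℝ x y) ^ (j + 1))
    (f' := fun y => (j + 1) * (inner ℝ x y) ^ j)
    (g := fun y : EuclideanSpace ℝ (Fin d) => Real.exp (-‖y‖ ^ 2))
    (g' := fun y => -2 * inner ℝ x y * Real.exp (-‖y‖ ^ 2)) (v := x)
    (by
      refine ((integrable_inner_pow_mul_exp hd x hx j).const_mul ((j : ℝ) + 1)).congr
        (.of_forall fun y => ?_)
      simp; ring)
    (by
      refine ((integrable_inner_pow_mul_exp hd x hx (j + 2)).const_mul (-2)).congr
        (.of_forall fun y => ?_)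
      simp; ring)
    (by simpa using integrable_inner_pow_mul_exp hd x hx (j + 1))
    (fun y _ => hd1 y) (fun y _ => hd2 y)
  have e1 : ∀ y : EuclideanSpace ℝ (Fin d), (ContinuousLinearMap.mul ℝ ℝ)
      ((inner ℝ x y) ^ (j + 1)) (-2 * inner ℝ x y * Real.exp (-‖y‖ ^ 2))
      = -2 * ((inner ℝ x y) ^ (j + 2) * Real.exp (-‖y‖ ^ 2)) := by
    intro y; simp; ring
  have e2 : ∀ y : EuclideanSpace ℝ (Fin d), (ContinuousLinearMap.mul ℝ ℝ)
      ((j + 1) * (inner ℝ x y) ^ j) (Real.exp (-‖y‖ ^ 2))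
      = (j + 1) * ((inner ℝ x y) ^ j * Real.exp (-‖y‖ ^ 2)) := by
    intro y; simp; ring
  simp_rw [e1, e2, integral_const_mul] at key
  linarith

lemma integral_inner_mul_exp (x : EuclideanSpace ℝ (Fin d)) :
    ∫ y : EuclideanSpace ℝ (Fin d), (inner ℝ x y) ^ 1 * Real.exp (-‖y‖ ^ 2) = 0 := by
  have h := integral_neg_eq_self
    (fun y : EuclideanSpace ℝ (Fin d) => (inner ℝ x y) ^ 1 * Real.exp (-‖y‖ ^ 2)) volume
  simp only [inner_neg_right, norm_neg, pow_one, neg_mul, integral_neg] at h ⊢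
  linarith

/-- Homogeneity separates the variables in polar coordinates: `r ^ j` comes from the integrand and
`r ^ (d - 1)` from the volume. -/
lemma integral_inner_pow_mul_exp_polar (hd : 0 < d) (x : EuclideanSpace ℝ (Fin d)) (j : ℕ) :
    ∫ y : EuclideanSpace ℝ (Fin d), (inner ℝ x y) ^ j * Real.exp (-‖y‖ ^ 2)
      = (∫ u : UnitSphere d, (inner ℝ x (u : EuclideanSpace ℝ (Fin d))) ^ j
          ∂(volume : Measure (EuclideanSpace ℝ (Fin d))).toSphere)
        * ∫ r in Set.Ioi (0 : ℝ), r ^ (j + d - 1) * Real.exp (-r ^ 2) := by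
  have : Nonempty (Fin d) := ⟨⟨0, hd⟩⟩
  have hdim : Module.finrank ℝ (EuclideanSpace ℝ (Fin d)) = d := by simp
  calc
    _ = ∫ y : ({(0)}ᶜ : Set (EuclideanSpace ℝ (Fin d))), (inner ℝ x y.1) ^ j * Real.exp (-‖y.1‖ ^ 2)
          ∂(volume.comap Subtype.val) := by
      rw [integral_subtype_comap (measurableSet_singleton _).compl
        fun y => (inner ℝ x y) ^ j * Real.exp (-‖y‖ ^ 2), restrict_compl_singleton]
    _ = ∫ p : UnitSphere d × Set.Ioi (0 : ℝ),
          (inner ℝ x (p.1 : (EuclideanSpace ℝ (Fin d)))) ^ j * ((p.2 : ℝ) ^ j * Real.exp (-(p.2 : ℝ) ^ 2))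
          ∂(volume : Measure (EuclideanSpace ℝ (Fin d))).toSphere.prod (.volumeIoiPow (Module.finrank ℝ (EuclideanSpace ℝ (Fin d)) - 1)) := by
      rw [← (Measure.measurePreserving_homeomorphUnitSphereProd
        (volume : Measure (EuclideanSpace ℝ (Fin d)))).integral_comp (Homeomorph.measurableEmbedding _)]
      refine integral_congr_ae (.of_forall fun y => ?_)
      have hy : ‖y.1‖ ≠ 0 := norm_ne_zero_iff.2 y.2
      simp only [homeomorphUnitSphereProd_apply_fst_coe, homeomorphUnitSphereProd_apply_snd_coe,
        inner_smul_right]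
      rw [mul_pow, inv_pow]
      field_simp
    _ = _ := by
      rw [integral_prod_mul (fun u : UnitSphere d => (inner ℝ x (u : (EuclideanSpace ℝ (Fin d)))) ^ j)
        (fun r : Set.Ioi (0 : ℝ) => (r : ℝ) ^ j * Real.exp (-(r : ℝ) ^ 2))]
      congr 1
      simp only [Measure.volumeIoiPow, ENNReal.ofReal]
      rw [integral_withDensity_eq_integral_smul,
        integral_subtype_comap measurableSet_Ioi fun a : ℝ =>
          Real.toNNReal (a ^ (Module.finrank ℝ (EuclideanSpace ℝ (Fin d)) - 1)) • (a ^ j * Real.exp (-a ^ 2)),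
        setIntegral_congr_fun measurableSet_Ioi fun r hr => ?_]
      · rw [NNReal.smul_def, Real.coe_toNNReal _ (pow_nonneg (le_of_lt hr) _), smul_eq_mul, hdim,
          ← mul_assoc, ← pow_add]
        congr 2
        omega
      · exact (measurable_subtype_coe.pow_const _).real_toNNReal

/-- The moments of the coordinate `⟨x, u⟩` of a uniformly distributed point `u` of the sphere
satisfy a two-term recursion. -/
lemma exists_probabilityMeasure_sphere_moments (hd : 2 ≤ d) :
    ∃ σ : Measure (UnitSphere d), IsProbabilityMeasure σ ∧
      ∀ x : UnitSphere d,
        (∫ u : UnitSphere d, (inner ℝ (x : EuclideanSpace ℝ (Fin d))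
          (u : EuclideanSpace ℝ (Fin d))) ^ 1 ∂σ = 0) ∧
        ∀ j : ℕ, ((j : ℝ) + d) * ∫ u : UnitSphere d, (inner ℝ (x : EuclideanSpace ℝ (Fin d))
            (u : EuclideanSpace ℝ (Fin d))) ^ (j + 2) ∂σ
          = ((j : ℝ) + 1) * ∫ u : UnitSphere d, (inner ℝ (x : EuclideanSpace ℝ (Fin d))
            (u : EuclideanSpace ℝ (Fin d))) ^ j ∂σ := by
  have hd0 : 0 < d := by omega
  have : Nonempty (Fin d) := ⟨⟨0, hd0⟩⟩
  set τ := (volume : Measure (EuclideanSpace ℝ (Fin d))).toSphere with hτ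
  have hτ0 : τ ≠ 0 := Measure.toSphere_ne_zero _
  have : NeZero τ := ⟨hτ0⟩
  refine ⟨(τ Set.univ)⁻¹ • τ, isProbabilityMeasureSMul, fun x => ?_⟩
  have hx : ‖(x : EuclideanSpace ℝ (Fin d))‖ = 1 := by simp
  simp only [integral_smul_measure, smul_eq_mul]
  constructor
  · have h := integral_inner_pow_mul_exp_polar hd0 (x : EuclideanSpace ℝ (Fin d)) 1
    rw [integral_inner_mul_exp] at h
    have hp := integral_Ioi_pow_mul_exp_neg_sq_pos (1 + d - 1)
    rcases mul_eq_zero.1 h.symm with h | h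
    · rw [← hτ] at h
      rw [h, mul_zero]
    · exact absurd h hp.ne'
  · intro j
    have h := integral_inner_pow_mul_exp_succ hd0 (x : EuclideanSpace ℝ (Fin d)) hx j
    rw [integral_inner_pow_mul_exp_polar hd0, integral_inner_pow_mul_exp_polar hd0, ← hτ] at h
    have e : j + 2 + d - 1 = (j + d - 1) + 2 := by omega
    have hc : (((j + d - 1 : ℕ) : ℝ) + 1) = j + d := by
      rw [Nat.cast_sub (by omega)]; push_cast; ring
    -- The radial integral gains `(j + d) / 2` while the full integral gains `(j + 1) / 2`; the
    -- quotient is the spherical recursion.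
    rw [e, integral_Ioi_pow_mul_exp_neg_sq_succ, hc] at h
    have hp := integral_Ioi_pow_mul_exp_neg_sq_pos (j + d - 1)
    set ρ := ∫ r in Set.Ioi (0 : ℝ), r ^ (j + d - 1) * Real.exp (-r ^ 2)
    set a := ∫ u : UnitSphere d, (inner ℝ (x : EuclideanSpace ℝ (Fin d))
            (u : EuclideanSpace ℝ (Fin d))) ^ (j + 2) ∂τ
    set b := ∫ u : UnitSphere d, (inner ℝ (x : EuclideanSpace ℝ (Fin d))
            (u : EuclideanSpace ℝ (Fin d))) ^ j ∂τ
    have : ((j : ℝ) + d) * a = (j + 1) * b := by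
      have h2 : ρ * (((j : ℝ) + d) * a) = ρ * ((j + 1) * b) := by linarith
      exact mul_left_cancel₀ hp.ne' h2
    calc _ = ((τ Set.univ)⁻¹).toReal * (((j : ℝ) + d) * a) := by ring
      _ = _ := by rw [this]; ring

end Gaussian

/-! ### Differential identities for Legendre polynomials. -/

open Polynomial in
/-- `legendreP d k` as a polynomial. -/
noncomputable def legendrePoly (d : ℕ) : ℕ → ℝ[X]
  | 0 => 1
  | 1 => X
  | (j + 2) =>
      C ((2 * ((j : ℝ) + 2) + d - 4) / (((j : ℝ) + 2) + d - 3)) * X * legendrePoly d (j + 1)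
        - C ((((j : ℝ) + 2) - 1) / (((j : ℝ) + 2) + d - 3)) * legendrePoly d j

namespace legendrePoly

open Polynomial

variable {d : ℕ}

@[simp] lemma eval_eq (d : ℕ) (t : ℝ) : ∀ k, (legendrePoly d k).eval t = legendreP d k t
  | 0 => by simp [legendrePoly, legendreP]
  | 1 => by simp [legendrePoly, legendreP]
  | (j + 2) => by
    simp [legendrePoly, legendreP, eval_eq d t (j + 1), eval_eq d t j]

lemma natCast_add_sub_one_ne_zero (hd : 3 ≤ d) (j : ℕ) : (j : ℝ) + d - 1 ≠ 0 := by
  have : (3 : ℝ) ≤ d := by exact_mod_cast hd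
  have := Nat.cast_nonneg (α := ℝ) j
  linarith

lemma recurrence (hd : 3 ≤ d) (j : ℕ) :
    ((j : ℝ[X]) + (d : ℝ[X]) - 1) * legendrePoly d (j + 2)
      = (2 * (j : ℝ[X]) + (d : ℝ[X])) * X * legendrePoly d (j + 1) - ((j : ℝ[X]) + 1) * legendrePoly d j := by
  have h0 := natCast_add_sub_one_ne_zero hd j
  have e1 : ((j : ℝ[X]) + (d : ℝ[X]) - 1) = C ((j : ℝ) + d - 1) := by simp
  have e2 : (2 * (j : ℝ[X]) + (d : ℝ[X])) = C (2 * (j : ℝ) + d) := by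
    simp only [map_add, map_mul, map_natCast, map_ofNat]
  have e3 : ((j : ℝ[X]) + 1) = C ((j : ℝ) + 1) := by simp
  rw [e1, e2, e3, legendrePoly, mul_sub, ← mul_assoc, ← mul_assoc, ← mul_assoc, ← C_mul, ← C_mul]
  congr 4
  · rw [show (j : ℝ) + 2 + d - 3 = j + d - 1 by ring]
    field_simp
    ring
  · rw [show (j : ℝ) + 2 + d - 3 = j + d - 1 by ring]
    field_simp
    ring

/-- Induction along the differentiated recurrence. Multiplying by `j + d - 1` removes its
denominators. -/
lemma derivative_raise (hd : 3 ≤ d) (k : ℕ) :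
    (1 - X ^ 2) * derivative (legendrePoly d k)
      = ((k : ℝ[X]) + (d : ℝ[X]) - 2) * (X * legendrePoly d k - legendrePoly d (k + 1)) := by
  induction k using Nat.strong_induction_on with
  | _ k ih =>
    match k, ih with
    | 0, _ => simp [legendrePoly]
    | 1, _ =>
      have h := recurrence hd 0
      simp only [legendrePoly, derivative_X] at h ⊢
      push_cast at h ⊢
      linear_combination h
    | (j + 2), ih =>
      have h0 := recurrence hd j
      have h1 := recurrence hd (j + 1)
      have ih0 := ih j (by omega)
      have ih1 := ih (j + 1) (by omega)
      have hc : ((j : ℝ[X]) + (d : ℝ[X]) - 1) ≠ 0 := by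
        have e1 : ((j : ℝ[X]) + (d : ℝ[X]) - 1) = C ((j : ℝ) + d - 1) := by simp
        rw [e1]
        exact C_ne_zero.2 (natCast_add_sub_one_ne_zero hd j)
      have h' := congrArg derivative h0
      simp only [derivative_mul, derivative_sub, derivative_add, derivative_natCast,
        derivative_one, derivative_X, derivative_ofNat] at h'
      refine mul_left_cancel₀ hc ?_
      push_cast at *
      linear_combination (1 - X ^ 2) * h' + (2 * (j : ℝ[X]) + (d : ℝ[X])) * X * ih1 - ((j : ℝ[X]) + 1) * ih0
        + ((j : ℝ[X]) + (d : ℝ[X]) - 1) * h1 - ((j : ℝ[X]) + (d : ℝ[X]) - 2) * X * h0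

lemma derivative_lower (hd : 3 ≤ d) (k : ℕ) :
    (1 - X ^ 2) * derivative (legendrePoly d (k + 1))
      = ((k : ℝ[X]) + 1) * (legendrePoly d k - X * legendrePoly d (k + 1)) := by
  have h := derivative_raise hd (k + 1)
  have h0 := recurrence hd k
  push_cast at h
  linear_combination h - h0

end legendrePoly

/-! ### Mean squares of Legendre polynomials. -/

/-- A linear functional on polynomials with the moments of a coordinate of a uniformly distributed
point of the sphere. -/
structure IsSphereFunctional (d : ℕ) (L : Polynomial ℝ →ₗ[ℝ] ℝ) : Prop where
  apply_one : L 1 = 1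
  apply_X : L Polynomial.X = 0
  apply_X_pow : ∀ j : ℕ, ((j : ℝ) + d) * L (Polynomial.X ^ (j + 2))
    = ((j : ℝ) + 1) * L (Polynomial.X ^ j)

namespace IsSphereFunctional

open Polynomial

variable {d : ℕ} {L : ℝ[X] →ₗ[ℝ] ℝ}

/-- Integration by parts against the weight `(1 - t ^ 2) ^ ((d - 3) / 2)`; on monomials it is the
moment recursion. -/
lemma map_derivative (hL : IsSphereFunctional d L) (p : ℝ[X]) :
    L ((1 - X ^ 2) * derivative p) = ((d : ℝ) - 1) * L (X * p) := by
  induction p using Polynomial.induction_on' with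
  | add p q hp hq => simp only [mul_add, map_add, hp, hq]
  | monomial n a =>
    rw [← C_mul_X_pow_eq_monomial, derivative_C_mul_X_pow]
    cases n with
    | zero =>
      have : X * (C a * X ^ 0) = a • (X : ℝ[X]) := by rw [smul_eq_C_mul]; ring
      rw [this, map_smul, hL.apply_X]
      simp
    | succ i =>
      have e1 : (1 - X ^ 2) * (C (a * ((i + 1 : ℕ) : ℝ)) * X ^ (i + 1 - 1))
          = (a * (i + 1 : ℝ)) • (X ^ i : ℝ[X]) - (a * (i + 1 : ℝ)) • (X ^ (i + 2) : ℝ[X]) := by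
        rw [smul_eq_C_mul, smul_eq_C_mul, Nat.add_sub_cancel]
        push_cast
        ring
      have e2 : X * (C a * X ^ (i + 1)) = a • (X ^ (i + 2) : ℝ[X]) := by
        rw [smul_eq_C_mul]; ring
      rw [e1, e2, map_sub, map_smul, map_smul, map_smul, smul_eq_mul, smul_eq_mul, smul_eq_mul]
      linear_combination -a * hL.apply_X_pow i

lemma apply_C_mul (L : ℝ[X] →ₗ[ℝ] ℝ) (a : ℝ) (p : ℝ[X]) : L (C a * p) = a * L p := by
  rw [← smul_eq_C_mul, map_smul, smul_eq_mul]

/-- The only orthogonality needed. Integrating by parts with `P_{m+1} P_{m+2}`, lowering one factor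
and raising the other, cancels the terms `X P_{m+1} P_{m+2}` and links `P_m P_{m+2}` to `P_{m+1}
P_{m+3}`. -/
lemma map_legendrePoly_mul_add_two (hd : 3 ≤ d) (hL : IsSphereFunctional d L) (k : ℕ) :
    L (legendrePoly d k * legendrePoly d (k + 2)) = 0 := by
  induction k with
  | zero =>
    have h := hL.apply_X_pow 0
    have hr := legendrePoly.recurrence hd 0
    have e : ((0 : ℕ) : ℝ[X]) + (d : ℝ[X]) - 1 = C ((d : ℝ) - 1) := by simp
    have hr' : C ((d : ℝ) - 1) * (legendrePoly d 0 * legendrePoly d 2)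
        = C (d : ℝ) * X ^ 2 - 1 := by
      rw [← e, mul_left_comm, hr]
      simp only [legendrePoly, Nat.cast_zero, map_natCast]
      ring
    have h2 := congrArg L hr'
    rw [apply_C_mul, map_sub, apply_C_mul] at h2
    simp only [Nat.cast_zero, zero_add, pow_zero] at h
    rw [h, one_mul, sub_self] at h2
    have : (d : ℝ) - 1 ≠ 0 := by simpa using legendrePoly.natCast_add_sub_one_ne_zero hd 0
    exact (mul_eq_zero.1 h2).resolve_left this
  | succ m ih =>
    have h := hL.map_derivative (legendrePoly d (m + 1) * legendrePoly d (m + 2))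
    have h1 := legendrePoly.derivative_lower hd m
    have h2 := legendrePoly.derivative_raise hd (m + 2)
    have e : (1 - X ^ 2) * derivative (legendrePoly d (m + 1) * legendrePoly d (m + 2))
        = C ((m : ℝ) + 1) * (legendrePoly d m * legendrePoly d (m + 2))
          + C ((d : ℝ) - 1) * (X * (legendrePoly d (m + 1) * legendrePoly d (m + 2)))
          - C ((m : ℝ) + d) * (legendrePoly d (m + 1) * legendrePoly d (m + 1 + 2)) := by
      rw [derivative_mul]
      simp only [map_add, map_sub, map_natCast, map_one]
      push_cast at h2
      linear_combination legendrePoly d (m + 2) * h1 + legendrePoly d (m + 1) * h2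
    rw [e, map_sub, map_add, apply_C_mul, apply_C_mul, apply_C_mul, ih] at h
    have h3 : ((m : ℝ) + d) * L (legendrePoly d (m + 1) * legendrePoly d (m + 1 + 2)) = 0 := by
      linarith
    have : (m : ℝ) + d ≠ 0 := by positivity
    exact (mul_eq_zero.1 h3).resolve_left this

/-- By orthogonality, two consecutive recurrences express both mean squares through that of `X
P_{j+1} P_{j+2}`, which is eliminated. -/
lemma map_legendrePoly_sq_succ (hd : 3 ≤ d) (hL : IsSphereFunctional d L) (j : ℕ) :
    ((j : ℝ) + d - 1) * (2 * j + d + 2) * L (legendrePoly d (j + 2) ^ 2)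
      = (2 * (j : ℝ) + d) * (j + 2) * L (legendrePoly d (j + 1) ^ 2) := by
  have h1 : C ((j : ℝ) + d - 1) * legendrePoly d (j + 2) ^ 2
      = C (2 * (j : ℝ) + d) * (X * legendrePoly d (j + 1) * legendrePoly d (j + 2))
        - C ((j : ℝ) + 1) * (legendrePoly d j * legendrePoly d (j + 2)) := by
    have h := legendrePoly.recurrence hd j
    simp only [map_add, map_sub, map_natCast, map_one, map_mul, map_ofNat]
    linear_combination legendrePoly d (j + 2) * h
  have h2 : C ((j : ℝ) + d) * (legendrePoly d (j + 1) * legendrePoly d (j + 1 + 2))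
      = C (2 * (j : ℝ) + d + 2) * (X * legendrePoly d (j + 1) * legendrePoly d (j + 2))
        - C ((j : ℝ) + 2) * legendrePoly d (j + 1) ^ 2 := by
    have h := legendrePoly.recurrence hd (j + 1)
    simp only [map_add, map_natCast, map_mul, map_ofNat]
    push_cast at h
    linear_combination legendrePoly d (j + 1) * h
  have h1' := congrArg L h1
  have h2' := congrArg L h2
  rw [apply_C_mul, map_sub, apply_C_mul, apply_C_mul, hL.map_legendrePoly_mul_add_two hd] at h1'
  rw [apply_C_mul, map_sub, apply_C_mul, apply_C_mul, hL.map_legendrePoly_mul_add_two hd] at h2'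
  linear_combination (2 * (j : ℝ) + d + 2) * h1' - (2 * (j : ℝ) + d) * h2'

end IsSphereFunctional

lemma harmonicDim_succ_add_two (e j : ℕ) :
    harmonicDim (j + 1) (e + 2) = (e + j + 1).choose e + (e + j).choose e := by
  unfold harmonicDim
  rw [show e + 2 + (j + 1) - 1 = e + j + 1 + 1 by omega, show e + 2 - 1 = e + 1 by omega,
    show e + 2 + (j + 1) - 3 = e + j by omega, Nat.choose_succ_succ', Nat.choose_succ_succ' (e + j) e]
  omega

lemma succ_mul_choose_add_succ (e j : ℕ) :
    (j + 1) * (e + j + 1).choose e = (e + j + 1) * (e + j).choose e := by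
  have h := Nat.choose_mul_succ_eq (e + j) e
  rw [show e + j + 1 - e = j + 1 by omega] at h
  linarith

lemma succ_mul_harmonicDim (e j : ℕ) :
    (j + 1) * harmonicDim (j + 1) (e + 2) = (e + j).choose e * (e + 2 * j + 2) := by
  have h := succ_mul_choose_add_succ e j
  rw [harmonicDim_succ_add_two]
  linarith

namespace IsSphereFunctional

variable {d : ℕ} {L : Polynomial ℝ →ₗ[ℝ] ℝ}

lemma map_legendrePoly_sq_mul_harmonicDim (hd : 3 ≤ d) (hL : IsSphereFunctional d L) (j : ℕ) :
    L (legendrePoly d (j + 1) ^ 2) * harmonicDim (j + 1) d = 1 := by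
  obtain ⟨e, rfl⟩ : ∃ e, d = e + 2 := ⟨d - 2, by omega⟩
  -- The product form of `(j + 1) * harmonicDim (j + 1) (e + 2)` has no subtraction and suits the
  -- induction.
  suffices h : L (legendrePoly (e + 2) (j + 1) ^ 2) * ((e + j).choose e * (e + 2 * j + 2))
      = j + 1 by
    have h2 : ((j : ℝ) + 1) * harmonicDim (j + 1) (e + 2)
        = (e + j).choose e * (e + 2 * j + 2) := by exact_mod_cast succ_mul_harmonicDim e j
    rw [← h2] at h
    have h3 : (j : ℝ) + 1 ≠ 0 := by positivity
    refine mul_left_cancel₀ h3 ?_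
    linarith
  induction j with
  | zero =>
    have h := hL.apply_X_pow 0
    simp only [Nat.cast_zero, pow_zero, hL.apply_one] at h
    push_cast at h
    simp only [legendrePoly, Nat.add_zero, Nat.choose_self, Nat.cast_zero]
    push_cast
    linarith
  | succ j ih =>
    have h1 := hL.map_legendrePoly_sq_succ hd j
    have h2 : ((j : ℝ) + 1) * (e + j + 1).choose e = (e + j + 1) * (e + j).choose e := by
      exact_mod_cast succ_mul_choose_add_succ e j
    have h3 : (j : ℝ) + 1 ≠ 0 := by positivity
    refine mul_left_cancel₀ h3 ?_
    push_cast at h1 ⊢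
    rw [← add_assoc e j 1]
    linear_combination L (legendrePoly (e + 2) (j + 2) ^ 2) * (e + 2 * j + 4) * h2
      + (e + j).choose e * h1 + (j + 2) * ih

end IsSphereFunctional

/-! ### Explicit estimates in low degree and dimension. -/

/-- Bernstein products on `[a, b]`. They reduce polynomial inequalities to linear arithmetic over
monomials, after cutting the interval where necessary. -/
lemma sub_pow_mul_nonneg {s a b : ℝ} (ha : a ≤ s) (hb : s ≤ b) (i j : ℕ) :
    0 ≤ (s - a) ^ i * (b - s) ^ j :=
  mul_nonneg (pow_nonneg (sub_nonneg.2 ha) i) (pow_nonneg (sub_nonneg.2 hb) j)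

lemma legendreP_three_four (t : ℝ) :
    legendreP 3 4 t =
      35 / 8 * t ^ 4 - 15 / 4 * t ^ 2 + 3 / 8 := by
  norm_num [legendreP]
  ring

lemma legendreP_three_five (t : ℝ) :
    legendreP 3 5 t =
      63 / 8 * t ^ 5 - 35 / 4 * t ^ 3 + 15 / 8 * t := by
  norm_num [legendreP]
  ring

lemma legendreP_three_six (t : ℝ) :
    legendreP 3 6 t =
      231 / 16 * t ^ 6 - 315 / 16 * t ^ 4 + 105 / 16 * t ^ 2 - 5 / 16 := by
  norm_num [legendreP]
  ring

lemma legendreP_three_seven (t : ℝ) :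
    legendreP 3 7 t =
      429 / 16 * t ^ 7 - 693 / 16 * t ^ 5 + 315 / 16 * t ^ 3 - 35 / 16 * t := by
  norm_num [legendreP]
  ring

lemma legendreP_three_eight (t : ℝ) :
    legendreP 3 8 t =
      6435 / 128 * t ^ 8 - 3003 / 32 * t ^ 6 + 3465 / 64 * t ^ 4 - 315 / 32 * t ^ 2 + 35 / 128 := by
  norm_num [legendreP]
  ring

lemma legendreP_three_nine (t : ℝ) :
    legendreP 3 9 t =
      12155 / 128 * t ^ 9 - 6435 / 32 * t ^ 7 + 9009 / 64 * t ^ 5 - 1155 / 32 * t ^ 3 + 315 / 128 * t := by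
  norm_num [legendreP]
  ring

lemma legendreP_four_four (t : ℝ) :
    legendreP 4 4 t =
      16 / 5 * t ^ 4 - 12 / 5 * t ^ 2 + 1 / 5 := by
  norm_num [legendreP]
  ring

lemma legendreP_four_five (t : ℝ) :
    legendreP 4 5 t =
      16 / 3 * t ^ 5 - 16 / 3 * t ^ 3 + 1 * t := by
  norm_num [legendreP]
  ring

lemma legendreP_five_four (t : ℝ) :
    legendreP 5 4 t =
      21 / 8 * t ^ 4 - 7 / 4 * t ^ 2 + 1 / 8 := by
  norm_num [legendreP]
  ring

lemma legendreP_three_five_lt {t : ℝ} (h₁ : -(24 / 25) ≤ t) (h₂ : t ≤ (24 / 25)) :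
    legendreP 3 5 t < 1 / 2 := by
  rw [legendreP_three_five]
  rcases le_total t (-7 / 10) with h | h0
  · linarith [sub_pow_mul_nonneg h₁ h 0 5, sub_pow_mul_nonneg h₁ h 1 4,
      sub_pow_mul_nonneg h₁ h 2 3, sub_pow_mul_nonneg h₁ h 3 2, sub_pow_mul_nonneg h₁ h 4 1,
      sub_pow_mul_nonneg h₁ h 5 0]
  rcases le_total t (3 / 10) with h | h1
  · linarith [sub_pow_mul_nonneg h0 h 0 5, sub_pow_mul_nonneg h0 h 1 4,
      sub_pow_mul_nonneg h0 h 2 3, sub_pow_mul_nonneg h0 h 3 2, sub_pow_mul_nonneg h0 h 4 1,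
      sub_pow_mul_nonneg h0 h 5 0]
  linarith [sub_pow_mul_nonneg h1 h₂ 0 5, sub_pow_mul_nonneg h1 h₂ 1 4,
    sub_pow_mul_nonneg h1 h₂ 2 3, sub_pow_mul_nonneg h1 h₂ 3 2, sub_pow_mul_nonneg h1 h₂ 4 1,
    sub_pow_mul_nonneg h1 h₂ 5 0]

lemma legendreP_three_seven_lt {t : ℝ} (h₁ : -(24 / 25) ≤ t) (h₂ : t ≤ (24 / 25)) :
    legendreP 3 7 t < 1 / 2 := by
  rw [legendreP_three_seven]
  rcases le_total t (-4 / 5) with h | h0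
  · linarith [sub_pow_mul_nonneg h₁ h 0 7, sub_pow_mul_nonneg h₁ h 1 6,
      sub_pow_mul_nonneg h₁ h 2 5, sub_pow_mul_nonneg h₁ h 3 4, sub_pow_mul_nonneg h₁ h 4 3,
      sub_pow_mul_nonneg h₁ h 5 2, sub_pow_mul_nonneg h₁ h 6 1, sub_pow_mul_nonneg h₁ h 7 0]
  rcases le_total t (-1 / 10) with h | h1
  · linarith [sub_pow_mul_nonneg h0 h 0 7, sub_pow_mul_nonneg h0 h 1 6,
      sub_pow_mul_nonneg h0 h 2 5, sub_pow_mul_nonneg h0 h 3 4, sub_pow_mul_nonneg h0 h 4 3,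
      sub_pow_mul_nonneg h0 h 5 2, sub_pow_mul_nonneg h0 h 6 1, sub_pow_mul_nonneg h0 h 7 0]
  rcases le_total t (3 / 5) with h | h2
  · linarith [sub_pow_mul_nonneg h1 h 0 7, sub_pow_mul_nonneg h1 h 1 6,
      sub_pow_mul_nonneg h1 h 2 5, sub_pow_mul_nonneg h1 h 3 4, sub_pow_mul_nonneg h1 h 4 3,
      sub_pow_mul_nonneg h1 h 5 2, sub_pow_mul_nonneg h1 h 6 1, sub_pow_mul_nonneg h1 h 7 0]
  linarith [sub_pow_mul_nonneg h2 h₂ 0 7, sub_pow_mul_nonneg h2 h₂ 1 6,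
    sub_pow_mul_nonneg h2 h₂ 2 5, sub_pow_mul_nonneg h2 h₂ 3 4, sub_pow_mul_nonneg h2 h₂ 4 3,
    sub_pow_mul_nonneg h2 h₂ 5 2, sub_pow_mul_nonneg h2 h₂ 6 1, sub_pow_mul_nonneg h2 h₂ 7 0]

/-- The bound 0.9487 lies just above the square root of 9/10, the threshold for `t ^ 2` used in
dimension 4. -/
lemma legendreP_four_five_lt {t : ℝ} (h₁ : -(9487 / 10000) ≤ t) (h₂ : t ≤ (9487 / 10000)) :
    legendreP 4 5 t < 1 / 2 := by
  rw [legendreP_four_five]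
  rcases le_total t (-2 / 5) with h | h0
  · linarith [sub_pow_mul_nonneg h₁ h 0 5, sub_pow_mul_nonneg h₁ h 1 4,
      sub_pow_mul_nonneg h₁ h 2 3, sub_pow_mul_nonneg h₁ h 3 2, sub_pow_mul_nonneg h₁ h 4 1,
      sub_pow_mul_nonneg h₁ h 5 0]
  rcases le_total t (1 / 2) with h | h1
  · linarith [sub_pow_mul_nonneg h0 h 0 5, sub_pow_mul_nonneg h0 h 1 4,
      sub_pow_mul_nonneg h0 h 2 3, sub_pow_mul_nonneg h0 h 3 2, sub_pow_mul_nonneg h0 h 4 1,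
      sub_pow_mul_nonneg h0 h 5 0]
  linarith [sub_pow_mul_nonneg h1 h₂ 0 5, sub_pow_mul_nonneg h1 h₂ 1 4,
    sub_pow_mul_nonneg h1 h₂ 2 3, sub_pow_mul_nonneg h1 h₂ 3 2, sub_pow_mul_nonneg h1 h₂ 4 1,
    sub_pow_mul_nonneg h1 h₂ 5 0]

lemma legendreP_three_four_lt {t : ℝ} (h : t ^ 2 ≤ (889 / 1000)) :
    legendreP 3 4 t < 1 / 2 := by
  rw [legendreP_three_four]
  obtain ⟨s, hs⟩ : ∃ s, s = t ^ 2 := ⟨_, rfl⟩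
  have h₁ : 0 ≤ s := hs ▸ sq_nonneg t
  have h₂ : s ≤ (889 / 1000) := hs ▸ h
  suffices 35 / 8 * s ^ 2 - 15 / 4 * s + 3 / 8 < 1 / 2 by
    rw [hs] at this
    linarith
  linarith [sub_pow_mul_nonneg h₁ h₂ 0 2, sub_pow_mul_nonneg h₁ h₂ 1 1,
    sub_pow_mul_nonneg h₁ h₂ 2 0]

lemma legendreP_three_six_lt {t : ℝ} (h : t ^ 2 ≤ (576 / 625)) :
    legendreP 3 6 t < 1 / 2 := by
  rw [legendreP_three_six]
  obtain ⟨s, hs⟩ : ∃ s, s = t ^ 2 := ⟨_, rfl⟩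
  have h₁ : 0 ≤ s := hs ▸ sq_nonneg t
  have h₂ : s ≤ (576 / 625) := hs ▸ h
  suffices 231 / 16 * s ^ 3 - 315 / 16 * s ^ 2 + 105 / 16 * s - 5 / 16 < 1 / 2 by
    rw [hs] at this
    linarith
  rcases le_total s (3 / 10) with h | h0
  · linarith [sub_pow_mul_nonneg h₁ h 0 3, sub_pow_mul_nonneg h₁ h 1 2,
      sub_pow_mul_nonneg h₁ h 2 1, sub_pow_mul_nonneg h₁ h 3 0]
  linarith [sub_pow_mul_nonneg h0 h₂ 0 3, sub_pow_mul_nonneg h0 h₂ 1 2,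
    sub_pow_mul_nonneg h0 h₂ 2 1, sub_pow_mul_nonneg h0 h₂ 3 0]

lemma legendreP_three_eight_lt {t : ℝ} (h : t ^ 2 ≤ (576 / 625)) :
    legendreP 3 8 t < 1 / 2 := by
  rw [legendreP_three_eight]
  obtain ⟨s, hs⟩ : ∃ s, s = t ^ 2 := ⟨_, rfl⟩
  have h₁ : 0 ≤ s := hs ▸ sq_nonneg t
  have h₂ : s ≤ (576 / 625) := hs ▸ h
  suffices 6435 / 128 * s ^ 4 - 3003 / 32 * s ^ 3 + 3465 / 64 * s ^ 2 - 315 / 32 * s +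
    35 / 128 < 1 / 2 by
    rw [hs] at this
    linarith
  rcases le_total s (1 / 2) with h | h0
  · linarith [sub_pow_mul_nonneg h₁ h 0 4, sub_pow_mul_nonneg h₁ h 1 3,
      sub_pow_mul_nonneg h₁ h 2 2, sub_pow_mul_nonneg h₁ h 3 1, sub_pow_mul_nonneg h₁ h 4 0]
  linarith [sub_pow_mul_nonneg h0 h₂ 0 4, sub_pow_mul_nonneg h0 h₂ 1 3,
    sub_pow_mul_nonneg h0 h₂ 2 2, sub_pow_mul_nonneg h0 h₂ 3 1, sub_pow_mul_nonneg h0 h₂ 4 0]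

lemma legendreP_four_four_lt {t : ℝ} (h : t ^ 2 ≤ (859 / 1000)) :
    legendreP 4 4 t < 1 / 2 := by
  rw [legendreP_four_four]
  obtain ⟨s, hs⟩ : ∃ s, s = t ^ 2 := ⟨_, rfl⟩
  have h₁ : 0 ≤ s := hs ▸ sq_nonneg t
  have h₂ : s ≤ (859 / 1000) := hs ▸ h
  suffices 16 / 5 * s ^ 2 - 12 / 5 * s + 1 / 5 < 1 / 2 by
    rw [hs] at this
    linarith
  linarith [sub_pow_mul_nonneg h₁ h₂ 0 2, sub_pow_mul_nonneg h₁ h₂ 1 1,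
    sub_pow_mul_nonneg h₁ h₂ 2 0]

lemma legendreP_five_four_lt {t : ℝ} (h : t ^ 2 ≤ (209 / 250)) :
    legendreP 5 4 t < 1 / 2 := by
  rw [legendreP_five_four]
  obtain ⟨s, hs⟩ : ∃ s, s = t ^ 2 := ⟨_, rfl⟩
  have h₁ : 0 ≤ s := hs ▸ sq_nonneg t
  have h₂ : s ≤ (209 / 250) := hs ▸ h
  suffices 21 / 8 * s ^ 2 - 7 / 4 * s + 1 / 8 < 1 / 2 by
    rw [hs] at this
    linarith
  linarith [sub_pow_mul_nonneg h₁ h₂ 0 2, sub_pow_mul_nonneg h₁ h₂ 1 1,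
    sub_pow_mul_nonneg h₁ h₂ 2 0]

/-- Covers the window below `(24 / 25) ^ 2` left open by `legendreP_three_four_lt`; there the test
at the reflected point excludes `t`. -/
lemma legendreP_three_four_sub_double {t : ℝ} (h₁ : (889 / 1000) ≤ t ^ 2) (h₂ : t ^ 2 ≤ (576 / 625)) :
    1 / 2 < legendreP 3 4 t - legendreP 3 4 (2 * t ^ 2 - 1) := by
  rw [legendreP_three_four, legendreP_three_four]
  obtain ⟨s, hs⟩ : ∃ s, s = t ^ 2 := ⟨_, rfl⟩
  rw [← hs] at h₁ h₂
  suffices 0 < -70 * s ^ 4 + 140 * s ^ 3 - 685 / 8 * s ^ 2 + 65 / 4 * s - 9 / 8 by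
    rw [hs] at this
    linarith
  linarith [sub_pow_mul_nonneg h₁ h₂ 0 4, sub_pow_mul_nonneg h₁ h₂ 1 3,
    sub_pow_mul_nonneg h₁ h₂ 2 2, sub_pow_mul_nonneg h₁ h₂ 3 1, sub_pow_mul_nonneg h₁ h₂ 4 0]

lemma legendreP_four_four_sub_double {t : ℝ} (h₁ : (859 / 1000) ≤ t ^ 2) (h₂ : t ^ 2 ≤ (9 / 10)) :
    1 / 2 < legendreP 4 4 t - legendreP 4 4 (2 * t ^ 2 - 1) := by
  rw [legendreP_four_four, legendreP_four_four]
  obtain ⟨s, hs⟩ : ∃ s, s = t ^ 2 := ⟨_, rfl⟩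
  rw [← hs] at h₁ h₂
  suffices 0 < -256 / 5 * s ^ 4 + 512 / 5 * s ^ 3 - 64 * s ^ 2 + 68 / 5 * s - 13 / 10 by
    rw [hs] at this
    linarith
  linarith [sub_pow_mul_nonneg h₁ h₂ 0 4, sub_pow_mul_nonneg h₁ h₂ 1 3,
    sub_pow_mul_nonneg h₁ h₂ 2 2, sub_pow_mul_nonneg h₁ h₂ 3 1, sub_pow_mul_nonneg h₁ h₂ 4 0]

/-- The left side is `legendreForm 3 8 t`; by monotonicity this one estimate serves all degrees from
9 on. -/
lemma legendreP_three_nine_form_lt {t : ℝ} (h : t ^ 2 ≤ (576 / 625)) :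
    legendreP 3 9 t ^ 2 - 2 * t * legendreP 3 9 t * legendreP 3 8 t + legendreP 3 8 t ^ 2
      < (1 - t ^ 2) / 4 := by
  rw [legendreP_three_nine, legendreP_three_eight]
  obtain ⟨s, hs⟩ : ∃ s, s = t ^ 2 := ⟨_, rfl⟩
  have h₁ : 0 ≤ s := hs ▸ sq_nonneg t
  have h₂ : s ≤ (576 / 625) := hs ▸ h
  suffices 0 < 8690825 / 16384 * s ^ 9 - 38955345 / 16384 * s ^ 8 +
    18191745 / 4096 * s ^ 7 - 18327309 / 4096 * s ^ 6 +
    21524503 / 8192 * s ^ 5 - 7425495 / 8192 * s ^ 4 +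
    719565 / 4096 * s ^ 3 - 69825 / 4096 * s ^ 2 + 6929 / 16384 * s + 2871 / 16384 by
    rw [hs] at this
    linarith
  rcases le_total s (7 / 10) with h | h0
  · linarith [sub_pow_mul_nonneg h₁ h 0 9, sub_pow_mul_nonneg h₁ h 1 8,
      sub_pow_mul_nonneg h₁ h 2 7, sub_pow_mul_nonneg h₁ h 3 6, sub_pow_mul_nonneg h₁ h 4 5,
      sub_pow_mul_nonneg h₁ h 5 4, sub_pow_mul_nonneg h₁ h 6 3, sub_pow_mul_nonneg h₁ h 7 2,
      sub_pow_mul_nonneg h₁ h 8 1, sub_pow_mul_nonneg h₁ h 9 0]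
  linarith [sub_pow_mul_nonneg h0 h₂ 0 9, sub_pow_mul_nonneg h0 h₂ 1 8,
    sub_pow_mul_nonneg h0 h₂ 2 7, sub_pow_mul_nonneg h0 h₂ 3 6, sub_pow_mul_nonneg h0 h₂ 4 5,
    sub_pow_mul_nonneg h0 h₂ 5 4, sub_pow_mul_nonneg h0 h₂ 6 3, sub_pow_mul_nonneg h0 h₂ 7 2,
    sub_pow_mul_nonneg h0 h₂ 8 1, sub_pow_mul_nonneg h0 h₂ 9 0]


/-! ### Bounds uniform in the degree. -/

section Legendre

variable {d : ℕ}

lemma legendreP_recurrence (hd : 3 ≤ d) (j : ℕ) (t : ℝ) :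
    ((j : ℝ) + d - 1) * legendreP d (j + 2) t
      = (2 * j + d) * t * legendreP d (j + 1) t - (j + 1) * legendreP d j t := by
  have h := congrArg (Polynomial.eval t) (legendrePoly.recurrence hd j)
  simpa using h

lemma continuous_legendreP (d k : ℕ) : Continuous (legendreP d k) := by
  have h := (legendrePoly d k).continuous
  simpa only [legendrePoly.eval_eq] using h

lemma legendreP_apply_one (hd : 3 ≤ d) (k : ℕ) : legendreP d k 1 = 1 := by
  induction k using Nat.strong_induction_on with
  | _ k ih =>
    match k, ih with
    | 0, _ => rfl
    | 1, _ => rfl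
    | (j + 2), ih =>
      have h := legendreP_recurrence hd j 1
      rw [ih j (by omega), ih (j + 1) (by omega)] at h
      refine mul_left_cancel₀ (legendrePoly.natCast_add_sub_one_ne_zero hd j) ?_
      linarith

/-- A quadratic form in two consecutive Legendre polynomials that controls their size. -/
noncomputable def legendreForm (d k : ℕ) (t : ℝ) : ℝ :=
  legendreP d (k + 1) t ^ 2 - 2 * t * legendreP d (k + 1) t * legendreP d k t + legendreP d k t ^ 2

/-- With `p, q, r` of degrees `k + 2, k + 1, k`, consecutive forms are `(p - t q)² + (1 - t²) q²`
and `(t q - r)² + (1 - t²) q²`. The recurrence makes `p - t q` a multiple of `t q - r` by `(k + 1) /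
(k + d - 1) ≤ 1`. -/
lemma legendreForm_antitone (hd : 3 ≤ d) (t : ℝ) : Antitone fun k => legendreForm d k t := by
  refine antitone_nat_of_succ_le fun k => ?_
  have h := legendreP_recurrence hd k t
  have hd' : (3 : ℝ) ≤ d := by exact_mod_cast hd
  have hk : (0 : ℝ) ≤ k := k.cast_nonneg
  unfold legendreForm
  set p := legendreP d (k + 2) t
  set q := legendreP d (k + 1) t
  set r := legendreP d k t
  have h1 : ((k : ℝ) + d - 1) * (p - t * q) = (k + 1) * (t * q - r) := by linarith
  have h2 : (p - t * q) ^ 2 ≤ (t * q - r) ^ 2 := by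
    refine sq_le_sq.2 ?_
    have h3 := congrArg abs h1
    rw [abs_mul, abs_mul, abs_of_pos (show 0 < (k : ℝ) + d - 1 by linarith),
      abs_of_pos (show 0 < (k : ℝ) + 1 by linarith)] at h3
    nlinarith [abs_nonneg (p - t * q), abs_nonneg (t * q - r)]
  linarith

lemma mul_legendreP_sq_le_legendreForm (k : ℕ) (t : ℝ) :
    (1 - t ^ 2) * legendreP d (k + 1) t ^ 2 ≤ legendreForm d k t := by
  unfold legendreForm
  linarith [sq_nonneg (legendreP d k t - t * legendreP d (k + 1) t)]

lemma legendreP_three_lt {k : ℕ} (hk : 5 ≤ k) {t : ℝ} (ht : |t| ≤ 24 / 25) :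
    legendreP 3 k t < 1 / 2 := by
  have h1 := abs_le.1 ht
  have h2 : t ^ 2 ≤ 576 / 625 := by nlinarith [sq_abs t, abs_nonneg t]
  rcases lt_or_ge k 9 with hk9 | hk9
  · interval_cases k
    · exact legendreP_three_five_lt h1.1 h1.2
    · exact legendreP_three_six_lt h2
    · exact legendreP_three_seven_lt h1.1 h1.2
    · exact legendreP_three_eight_lt h2
  · obtain ⟨j, rfl⟩ : ∃ j, k = j + 1 := ⟨k - 1, by omega⟩
    have h3 : legendreForm 3 j t < (1 - t ^ 2) / 4 :=
      (legendreForm_antitone le_rfl t (show 8 ≤ j by omega)).trans_lt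
        (legendreP_three_nine_form_lt h2)
    have h4 := mul_legendreP_sq_le_legendreForm (d := 3) j t
    have h5 : legendreP 3 (j + 1) t ^ 2 < (1 / 2) ^ 2 := by
      by_contra! h
      nlinarith
    exact (abs_lt_of_sq_lt_sq' h5 (by norm_num)).2

/-- In dimension 4, `(j + 1) P_j` is the Chebyshev polynomial of the second kind, and its recurrence
`U_{j+2} = 2 t U_{j+1} - U_j` preserves this form. -/
lemma legendreP_four_form (j : ℕ) (t : ℝ) :
    (((j : ℝ) + 2) * legendreP 4 (j + 1) t) ^ 2
      - 2 * t * (((j : ℝ) + 2) * legendreP 4 (j + 1) t) * (((j : ℝ) + 1) * legendreP 4 j t)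
      + (((j : ℝ) + 1) * legendreP 4 j t) ^ 2 = 1 := by
  induction j with
  | zero => simp [legendreP]; ring
  | succ j ih =>
    have h := legendreP_recurrence (d := 4) (by norm_num) j t
    have e : ((j : ℝ) + 3) * legendreP 4 (j + 2) t
        = 2 * t * (((j : ℝ) + 2) * legendreP 4 (j + 1) t) - (((j : ℝ) + 1) * legendreP 4 j t) := by
      push_cast at h
      linarith
    push_cast
    rw [show (j : ℝ) + 1 + 2 = j + 3 by ring, show (j : ℝ) + 1 + 1 = j + 2 by ring, e]
    linarith

lemma le_sq_of_half_le_legendreP_four {k : ℕ} (hk : 6 ≤ k) {t : ℝ} (h : 1 / 2 ≤ legendreP 4 k t) :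
    45 / 49 ≤ t ^ 2 := by
  obtain ⟨j, rfl⟩ : ∃ j, k = j + 1 := ⟨k - 1, by omega⟩
  have hj : (5 : ℝ) ≤ j := by exact_mod_cast (show 5 ≤ j by omega)
  have hf := legendreP_four_form j t
  set a := ((j : ℝ) + 2) * legendreP 4 (j + 1) t with ha
  -- Degree at least 6 gives `j + 2 ≥ 7`; then `1 - t ^ 2 ≤ 1 / a ^ 2 ≤ 4 / 49`.
  have h1 : 7 / 2 ≤ a := by nlinarith
  have h2 : (1 - t ^ 2) * a ^ 2 ≤ 1 := by
    linarith [sq_nonneg (((j : ℝ) + 1) * legendreP 4 j t - t * a)]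
  have h3 : 49 / 4 ≤ a ^ 2 := by nlinarith
  by_contra! h4
  nlinarith [mul_le_mul_of_nonneg_left h3 (show 0 ≤ 1 - t ^ 2 by linarith)]

/-- The value 91 is attained at `d = k = 5`, and `4 / 91 < 6 / 125` is what Chebyshev needs. The
excluded pair has dimension 55, which is too small. -/
lemma le_harmonicDim {d k : ℕ} (hd : 5 ≤ d) (hk : 4 ≤ k) (h : ¬ (d = 5 ∧ k = 4)) :
    91 ≤ harmonicDim k d := by
  obtain ⟨e, rfl⟩ : ∃ e, d = e + 2 := ⟨d - 2, by omega⟩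
  obtain ⟨j, rfl⟩ : ∃ j, k = j + 1 := ⟨k - 1, by omega⟩
  rw [harmonicDim_succ_add_two]
  rcases Nat.lt_or_ge e 4 with he | he
  · obtain rfl : e = 3 := by omega
    have h1 := Nat.choose_le_choose 3 (show 8 ≤ 3 + j + 1 by omega)
    have h2 := Nat.choose_le_choose 3 (show 7 ≤ 3 + j by omega)
    have e1 : Nat.choose 8 3 = 56 := by decide
    have e2 : Nat.choose 7 3 = 35 := by decide
    omega
  · have h1 := Nat.choose_le_choose e (show e + 4 ≤ e + j + 1 by omega)
    have h2 := Nat.choose_le_choose e (show e + 3 ≤ e + j by omega)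
    rw [Nat.choose_symm_add] at h1 h2
    have h3 := Nat.choose_le_choose 4 (show 8 ≤ e + 4 by omega)
    have h4 := Nat.choose_le_choose 3 (show 7 ≤ e + 3 by omega)
    have e1 : Nat.choose 8 4 = 70 := by decide
    have e2 : Nat.choose 7 3 = 35 := by decide
    omega

end Legendre

/-! ### Tail bounds for the coordinate law. -/

/-- The law of a coordinate of a uniformly distributed point of the sphere, described by its
moments. -/
structure IsSphereCoordinateLaw (d : ℕ) (τ : Measure ℝ) : Prop where
  isProbabilityMeasure : IsProbabilityMeasure τ
  ae_mem : ∀ᵐ t ∂τ, t ∈ Set.Icc (-1 : ℝ) 1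
  integral_pow_one : ∫ t, t ^ 1 ∂τ = 0
  integral_pow_add_two : ∀ j : ℕ, ((j : ℝ) + d) * ∫ t, t ^ (j + 2) ∂τ
    = ((j : ℝ) + 1) * ∫ t, t ^ j ∂τ

namespace IsSphereCoordinateLaw

variable {d : ℕ} {τ : Measure ℝ}

lemma integrable_of_continuous (hτ : IsSphereCoordinateLaw d τ) {g : ℝ → ℝ} (hg : Continuous g) :
    Integrable g τ := by
  have := hτ.isProbabilityMeasure
  obtain ⟨C, hC⟩ := (isCompact_Icc (a := (-1 : ℝ)) (b := 1)).exists_bound_of_continuousOn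
    hg.continuousOn
  exact Integrable.of_bound hg.aestronglyMeasurable C (hτ.ae_mem.mono hC)

/-- Integration of polynomials as a linear functional. -/
noncomputable def functional (hτ : IsSphereCoordinateLaw d τ) : Polynomial ℝ →ₗ[ℝ] ℝ where
  toFun p := ∫ t, p.eval t ∂τ
  map_add' p q := by
    simp only [Polynomial.eval_add]
    exact integral_add (hτ.integrable_of_continuous p.continuous)
      (hτ.integrable_of_continuous q.continuous)
  map_smul' c p := by
    simp only [Polynomial.eval_smul, smul_eq_mul, integral_const_mul, RingHom.id_apply]

lemma functional_apply (hτ : IsSphereCoordinateLaw d τ) (p : Polynomial ℝ) :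
    hτ.functional p = ∫ t, p.eval t ∂τ := rfl

lemma isSphereFunctional (hτ : IsSphereCoordinateLaw d τ) :
    IsSphereFunctional d hτ.functional where
  apply_one := by
    have := hτ.isProbabilityMeasure
    simp [functional_apply]
  apply_X := by simpa [functional_apply] using hτ.integral_pow_one
  apply_X_pow j := by simpa [functional_apply] using hτ.integral_pow_add_two j

lemma integral_legendreP_sq_mul (hτ : IsSphereCoordinateLaw d τ) (hd : 3 ≤ d) {k : ℕ}
    (hk : 1 ≤ k) : (∫ t, legendreP d k t ^ 2 ∂τ) * harmonicDim k d = 1 := by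
  obtain ⟨j, rfl⟩ : ∃ j, k = j + 1 := ⟨k - 1, by omega⟩
  have h := hτ.isSphereFunctional.map_legendrePoly_sq_mul_harmonicDim hd j
  simpa [functional_apply] using h

lemma measureReal_le_of_pow (hτ : IsSphereCoordinateLaw d τ) {S : Set ℝ} {s c : ℝ} (hs : 0 < s)
    (hS : ∀ t ∈ S, s ≤ t ^ 2) (j : ℕ) (hc : ∫ t, t ^ (2 * j) ∂τ ≤ c * s ^ j) :
    τ.real S ≤ c := by
  have := hτ.isProbabilityMeasure
  have h := mul_meas_ge_le_integral_of_nonneg (μ := τ) (f := fun t : ℝ => t ^ (2 * j))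
    (.of_forall fun t => show 0 ≤ t ^ (2 * j) by rw [pow_mul]; positivity)
    (hτ.integrable_of_continuous (by fun_prop)) (s ^ j)
  have h2 : τ.real S ≤ τ.real {t | s ^ j ≤ t ^ (2 * j)} :=
    measureReal_mono fun t ht => by
      simp only [Set.mem_ofPred_eq, pow_mul]
      exact pow_le_pow_left₀ hs.le (hS t ht) j
  have h3 : 0 < s ^ j := by positivity
  refine h2.trans (le_of_mul_le_mul_left ?_ h3)
  linarith [h.trans hc]

lemma measureReal_half_le_legendreP (hτ : IsSphereCoordinateLaw d τ) (hd : 3 ≤ d) {k : ℕ}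
    (hk : 1 ≤ k) : τ.real {t | 1 / 2 ≤ legendreP d k t} * harmonicDim k d ≤ 4 := by
  have := hτ.isProbabilityMeasure
  have h := mul_meas_ge_le_integral_of_nonneg (μ := τ) (f := fun t : ℝ => legendreP d k t ^ 2)
    (.of_forall fun t => sq_nonneg _)
    (hτ.integrable_of_continuous ((continuous_legendreP d k).pow 2)) (1 / 4)
  have h2 : τ.real {t | 1 / 2 ≤ legendreP d k t} ≤ τ.real {t | 1 / 4 ≤ legendreP d k t ^ 2} :=
    measureReal_mono fun t (ht : 1 / 2 ≤ legendreP d k t) =>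
      show 1 / 4 ≤ legendreP d k t ^ 2 by nlinarith
  have h3 := hτ.integral_legendreP_sq_mul hd hk
  have h4 : (0 : ℝ) ≤ harmonicDim k d := Nat.cast_nonneg _
  nlinarith

lemma integral_pow_three (hτ : IsSphereCoordinateLaw 3 τ) (n : ℕ) :
    ∫ t, t ^ n ∂τ = (1 / 2) * ∫ t in (-1 : ℝ)..1, t ^ n := by
  have := hτ.isProbabilityMeasure
  rw [integral_pow]
  induction n using Nat.strong_induction_on with
  | _ n ih =>
    match n, ih with
    | 0, _ => norm_num
    | 1, _ =>
      have h := hτ.integral_pow_one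
      rw [h]
      norm_num
    | (j + 2), ih =>
      have h := hτ.integral_pow_add_two j
      rw [ih j (by omega)] at h
      have h0 : (j : ℝ) + (3 : ℕ) ≠ 0 := by positivity
      refine mul_left_cancel₀ h0 ?_
      rw [h]
      have h1 : (j : ℝ) + 1 ≠ 0 := by positivity
      have h2 : (j : ℝ) + 3 ≠ 0 := by positivity
      push_cast
      rw [show (j : ℝ) + 2 + 1 = j + 3 by ring]
      field_simp
      ring

lemma integral_eval_three (hτ : IsSphereCoordinateLaw 3 τ) (p : Polynomial ℝ) :
    ∫ t, p.eval t ∂τ = (1 / 2) * ∫ t in (-1 : ℝ)..1, p.eval t := by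
  induction p using Polynomial.induction_on' with
  | add p q hp hq =>
    simp only [Polynomial.eval_add]
    rw [integral_add (hτ.integrable_of_continuous p.continuous)
      (hτ.integrable_of_continuous q.continuous), intervalIntegral.integral_add
      (p.continuous.intervalIntegrable _ _) (q.continuous.intervalIntegrable _ _), hp, hq]
    ring
  | monomial n a =>
    simp only [Polynomial.eval_monomial]
    rw [integral_const_mul, intervalIntegral.integral_const_mul, hτ.integral_pow_three]
    ring

/-- On the two-dimensional sphere the coordinates are uniformly distributed. -/
lemma integral_three (hτ : IsSphereCoordinateLaw 3 τ) {g : ℝ → ℝ} (hg : Continuous g) :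
    ∫ t, g t ∂τ ≤ (1 / 2) * ∫ t in (-1 : ℝ)..1, g t := by
  have := hτ.isProbabilityMeasure
  refine le_of_forall_pos_le_add fun ε hε => ?_
  obtain ⟨p, hp⟩ := exists_polynomial_near_of_continuousOn (-1) 1 g hg.continuousOn (ε / 2)
    (half_pos hε)
  have h1 : ∫ t, g t ∂τ ≤ ∫ t, (p.eval t + ε / 2) ∂τ := by
    refine integral_mono_ae (hτ.integrable_of_continuous hg)
      (hτ.integrable_of_continuous (p.continuous.add continuous_const)) (hτ.ae_mem.mono ?_)
    intro t ht
    have := (abs_lt.1 (hp t ht)).1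
    simp only
    linarith
  have h2 : ∫ t in (-1 : ℝ)..1, p.eval t ≤ ∫ t in (-1 : ℝ)..1, (g t + ε / 2) := by
    refine intervalIntegral.integral_mono_on (by norm_num) (p.continuous.intervalIntegrable _ _)
      ((hg.add continuous_const).intervalIntegrable _ _) fun t ht => ?_
    have := (abs_lt.1 (hp t ht)).2
    linarith
  rw [integral_add (hτ.integrable_of_continuous p.continuous) (integrable_const _),
    hτ.integral_eval_three] at h1
  rw [intervalIntegral.integral_add (hg.intervalIntegrable _ _) intervalIntegrable_const] at h2
  simp at h1 h2
  linarith

/-- The comparison with the uniform law holds for continuous functions, so a ramp from `a` to `b`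
replaces the indicator. -/
lemma measureReal_le_abs_three (hτ : IsSphereCoordinateLaw 3 τ) {a b : ℝ} (ha : 0 ≤ a)
    (hab : a < b) (ha1 : a ≤ 1) : τ.real {t | b ≤ |t|} ≤ 1 - a := by
  have := hτ.isProbabilityMeasure
  set g : ℝ → ℝ := fun t => min 1 (max 0 ((|t| - a) / (b - a))) with hg
  have hgc : Continuous g := by fun_prop
  have hb : 0 < b - a := sub_pos.2 hab
  have hg0 : ∀ t, 0 ≤ g t := fun t => le_min zero_le_one (le_max_left _ _)
  have hg1 : ∀ t, g t ≤ 1 := fun t => min_le_left _ _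
  have hgb : ∀ t, b ≤ |t| → 1 ≤ g t := fun t ht =>
    le_min le_rfl (le_max_of_le_right ((one_le_div hb).2 (by linarith)))
  have hga : ∀ t, |t| ≤ a → g t ≤ 0 := fun t ht =>
    (min_le_right _ _).trans (max_le le_rfl (div_nonpos_of_nonpos_of_nonneg (by linarith) hb.le))
  have h1 : τ.real {t | b ≤ |t|} ≤ τ.real {t | 1 ≤ g t} := measureReal_mono hgb
  have h2 := mul_meas_ge_le_integral_of_nonneg (μ := τ) (f := g) (.of_forall hg0)
    (hτ.integrable_of_continuous hgc) 1
  have h3 := hτ.integral_three hgc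
  have hint : ∀ x y, IntervalIntegrable g volume x y := fun x y => hgc.intervalIntegrable x y
  have h4 : ∫ t in (-1 : ℝ)..(-a), g t ≤ 1 - a := by
    have := intervalIntegral.integral_mono_on (show (-1 : ℝ) ≤ -a by linarith) (hint _ _)
      (intervalIntegrable_const (c := (1 : ℝ))) fun t _ => hg1 t
    simp at this
    linarith
  have h5 : ∫ t in (-a)..a, g t ≤ 0 := by
    have := intervalIntegral.integral_mono_on (show -a ≤ a by linarith) (hint _ _)
      (intervalIntegrable_const (c := (0 : ℝ))) fun t ht => hga t (abs_le.2 ht)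
    simpa using this
  have h6 : ∫ t in a..(1 : ℝ), g t ≤ 1 - a := by
    have := intervalIntegral.integral_mono_on ha1 (hint _ _)
      (intervalIntegrable_const (c := (1 : ℝ))) fun t _ => hg1 t
    simpa using this
  have h7 := intervalIntegral.integral_add_adjacent_intervals (hint (-1) (-a)) (hint (-a) a)
  have h8 := intervalIntegral.integral_add_adjacent_intervals (hint (-1) a) (hint a 1)
  linarith

/-- A ridge function is close to few other ridge functions: closeness at the centre and at the
reflected centre forces the inner product of the centres into a set of small measure. -/
theorem measureReal_close_le (hτ : IsSphereCoordinateLaw d τ) (hd : 3 ≤ d) {k : ℕ} (hk : 4 ≤ k) :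
    τ.real {t | 1 / 2 ≤ legendreP d k t ∧
      legendreP d k t - legendreP d k (2 * t ^ 2 - 1) ≤ 1 / 2} ≤ 6 / 125 := by
  have := hτ.isProbabilityMeasure
  have h0 : ∫ t, t ^ 0 ∂τ = 1 := by simp
  have hm := hτ.integral_pow_add_two
  -- Here Chebyshev with mean square `1 / N` suffices, and only the first condition is used.
  by_cases hN : 5 ≤ d ∧ ¬ (d = 5 ∧ k = 4)
  · have h1 : τ.real {t | 1 / 2 ≤ legendreP d k t ∧
        legendreP d k t - legendreP d k (2 * t ^ 2 - 1) ≤ 1 / 2}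
        ≤ τ.real {t | 1 / 2 ≤ legendreP d k t} := measureReal_mono fun t ht => ht.1
    have h2 := hτ.measureReal_half_le_legendreP hd (show 1 ≤ k by omega)
    have h3 : (91 : ℝ) ≤ harmonicDim k d := by exact_mod_cast le_harmonicDim hN.1 hk hN.2
    nlinarith [measureReal_nonneg (μ := τ) (s := {t | 1 / 2 ≤ legendreP d k t})]
  obtain rfl | rfl | ⟨rfl, rfl⟩ : d = 3 ∨ d = 4 ∨ d = 5 ∧ k = 4 := by omega
  -- `a` is chosen so that `1 - a = 6 / 125`.
  · have h1 := hτ.measureReal_le_abs_three (a := 119 / 125) (b := 24 / 25) (by norm_num)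
      (by norm_num) (by norm_num)
    refine (measureReal_mono fun t ht => ?_).trans (h1.trans (by norm_num))
    by_contra h
    have hlt : |t| ≤ 24 / 25 := (not_le.1 h).le
    rcases hk.eq_or_lt with rfl | hk5
    · have h2 : t ^ 2 ≤ 576 / 625 := by nlinarith [sq_abs t, abs_nonneg t]
      rcases le_total (t ^ 2) (889 / 1000) with h3 | h3
      · exact (legendreP_three_four_lt h3).not_ge ht.1
      · exact (legendreP_three_four_sub_double h3 h2).not_ge ht.2
    · exact (legendreP_three_lt hk5 hlt).not_ge ht.1
  · have hm0 := hm 0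
    have hm2 := hm 2
    have hm4 := hm 4
    have hm6 := hm 6
    have hm8 := hm 8
    have hm10 := hm 10
    have hm12 := hm 12
    have hm14 := hm 14
    have hm16 := hm 16
    have hm18 := hm 18
    have hm20 := hm 20
    have hm22 := hm 22
    rw [h0] at hm0
    norm_num at hm0 hm2 hm4 hm6 hm8 hm10 hm12 hm14 hm16 hm18 hm20 hm22
    rcases lt_or_ge k 6 with hk6 | hk6
    -- Markov's inequality for `t ^ 20`; the exponents here and below make the moment divided by `s
    -- ^ j` at most 6/125.
    · refine hτ.measureReal_le_of_pow (s := 9 / 10) (by norm_num) (fun t ht => ?_) 10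
        (by norm_num; linarith)
      by_contra! h
      interval_cases k
      · rcases le_total (t ^ 2) (859 / 1000) with h3 | h3
        · exact (legendreP_four_four_lt h3).not_ge ht.1
        · exact (legendreP_four_four_sub_double h3 h.le).not_ge ht.2
      · have h1 := abs_le.1 (abs_le_of_sq_le_sq (show t ^ 2 ≤ (9487 / 10000) ^ 2 by linarith)
          (by norm_num))
        exact (legendreP_four_five_lt h1.1 h1.2).not_ge ht.1
    · exact hτ.measureReal_le_of_pow (s := 45 / 49) (by norm_num)
        (fun t ht => le_sq_of_half_le_legendreP_four hk6 ht.1) 12 (by norm_num; linarith)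
  · have hm0 := hm 0
    have hm2 := hm 2
    have hm4 := hm 4
    have hm6 := hm 6
    have hm8 := hm 8
    have hm10 := hm 10
    rw [h0] at hm0
    norm_num at hm0 hm2 hm4 hm6 hm8 hm10
    refine hτ.measureReal_le_of_pow (s := 836 / 1000) (by norm_num) (fun t ht => ?_) 6
      (by norm_num; linarith)
    by_contra! h
    exact (legendreP_five_four_lt (by linarith)).not_ge ht.1

end IsSphereCoordinateLaw

lemma exists_probabilityMeasure_sphere_coordinateLaw {d : ℕ} (hd : 2 ≤ d) :
    ∃ σ : Measure (UnitSphere d), IsProbabilityMeasure σ ∧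
      ∀ x : UnitSphere d, IsSphereCoordinateLaw d
        (σ.map fun u : UnitSphere d => inner ℝ (x : EuclideanSpace ℝ (Fin d)) (u : EuclideanSpace ℝ (Fin d))) := by
  obtain ⟨σ, hσ, h⟩ := exists_probabilityMeasure_sphere_moments hd
  refine ⟨σ, hσ, fun x => ?_⟩
  have hm : Measurable fun u : UnitSphere d =>
      (inner ℝ (x : EuclideanSpace ℝ (Fin d)) (u : EuclideanSpace ℝ (Fin d)) : ℝ) := by fun_prop
  have hpow : ∀ j : ℕ, ∫ t, t ^ j ∂(σ.map fun u : UnitSphere d => inner ℝ (x : EuclideanSpace ℝ (Fin d))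
      (u : EuclideanSpace ℝ (Fin d))) = ∫ u : UnitSphere d, (inner ℝ
        (x : EuclideanSpace ℝ (Fin d)) (u : EuclideanSpace ℝ (Fin d))) ^ j ∂σ := fun j =>
    integral_map hm.aemeasurable (by fun_prop)
  refine ⟨Measure.isProbabilityMeasure_map hm.aemeasurable, ?_, ?_, ?_⟩
  · refine (ae_map_iff hm.aemeasurable measurableSet_Icc).2 (.of_forall fun u => ?_)
    have := abs_real_inner_le_norm (x : EuclideanSpace ℝ (Fin d)) (u : EuclideanSpace ℝ (Fin d))
    simp only [norm_eq_of_mem_sphere, mul_one] at this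
    exact abs_le.1 this
  · rw [hpow, (h x).1]
  · intro j
    rw [hpow, hpow, (h x).2 j]

/-- Multiplied by 250 the claim reads `exp 125 ≤ (19 / 10) ^ 238 * (1 / 10) ^ 12`, and a decimal
bound for `exp 1` decides it. -/
lemma half_le_log_combination :
    1 / 2 ≤ Real.log (19 / 10) - 6 / 125 * (Real.log (19 / 10) - Real.log (1 / 10)) := by
  have h : (125 : ℝ) ≤ Real.log ((19 / 10) ^ 238 * (1 / 10) ^ 12) := by
    rw [Real.le_log_iff_exp_le (by positivity), show (125 : ℝ) = (125 : ℕ) * 1 by norm_num,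
      Real.exp_nat_mul]
    refine (pow_le_pow_left₀ (Real.exp_pos 1).le Real.exp_one_lt_d9.le 125).trans ?_
    norm_num
  rw [Real.log_mul (by positivity) (by positivity), Real.log_pow, Real.log_pow] at h
  push_cast at h
  linarith

/-! ### Ridge functions close to a given one. -/

section Sphere

variable {d : ℕ}

lemma continuous_ridge (k : ℕ) (β : ℝ) :
    Continuous (Function.uncurry (ridge k d β)) := by
  unfold ridge Function.uncurry
  exact continuous_const.mul ((continuous_legendreP d k).comp (by fun_prop))

lemma exists_abs_ridge_le (k : ℕ) (β : ℝ) :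
    ∃ M, ∀ u x : UnitSphere d, |ridge k d β u x| ≤ M := by
  obtain ⟨M, hM⟩ := (isCompact_univ (X := UnitSphere d × UnitSphere d)).exists_bound_of_continuousOn
    (continuous_ridge k β).continuousOn
  exact ⟨M, fun u x => hM (u, x) (Set.mem_univ _)⟩

/-- The image of `v` under the reflection that fixes the line through `u`. -/
noncomputable def sphereReflection (u v : UnitSphere d) : UnitSphere d :=
  ⟨(2 * inner ℝ (u : EuclideanSpace ℝ (Fin d)) (v : EuclideanSpace ℝ (Fin d))) •
    (u : EuclideanSpace ℝ (Fin d)) - (v : EuclideanSpace ℝ (Fin d)), by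
    rw [mem_sphere_zero_iff_norm, ← sq_eq_sq₀ (norm_nonneg _) zero_le_one, norm_sub_sq_real,
      norm_smul, inner_smul_left, norm_eq_of_mem_sphere, norm_eq_of_mem_sphere, Real.norm_eq_abs,
      mul_one, sq_abs]
    simp only [conj_trivial]
    ring⟩

lemma inner_sphereReflection_left (u v : UnitSphere d) :
    inner ℝ (sphereReflection u v : EuclideanSpace ℝ (Fin d)) (u : EuclideanSpace ℝ (Fin d))
      = inner ℝ (u : EuclideanSpace ℝ (Fin d)) (v : EuclideanSpace ℝ (Fin d)) := by
  simp only [sphereReflection, inner_sub_left, inner_smul_left, conj_trivial,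
    real_inner_self_eq_norm_sq, norm_eq_of_mem_sphere,
    real_inner_comm (v : EuclideanSpace ℝ (Fin d)) (u : EuclideanSpace ℝ (Fin d))]
  ring

lemma inner_sphereReflection_right (u v : UnitSphere d) :
    inner ℝ (sphereReflection u v : EuclideanSpace ℝ (Fin d)) (v : EuclideanSpace ℝ (Fin d))
      = 2 * inner ℝ (u : EuclideanSpace ℝ (Fin d)) (v : EuclideanSpace ℝ (Fin d)) ^ 2 - 1 := by
  simp only [sphereReflection, inner_sub_left, inner_smul_left, conj_trivial,
    real_inner_self_eq_norm_sq, norm_eq_of_mem_sphere]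
  ring

/-- Few ridge functions are uniformly close to a given one. -/
lemma measureReal_ridge_close_le (hd : 3 ≤ d) {k : ℕ} (hk : 4 ≤ k) {β : ℝ} (hβ : 0 < β)
    {σ : Measure (UnitSphere d)} [IsProbabilityMeasure σ]
    (hσ : ∀ x : UnitSphere d, IsSphereCoordinateLaw d (σ.map fun u : UnitSphere d =>
      inner ℝ (x : EuclideanSpace ℝ (Fin d)) (u : EuclideanSpace ℝ (Fin d))))
    (u : UnitSphere d) :
    σ.real {v | ∀ x, |ridge k d β u x - ridge k d β v x| ≤ β / 2} ≤ 6 / 125 := by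
  have hm : Measurable fun v : UnitSphere d =>
      (inner ℝ (u : EuclideanSpace ℝ (Fin d)) (v : EuclideanSpace ℝ (Fin d)) : ℝ) := by fun_prop
  have h := (hσ u).measureReal_close_le hd hk
  have hc := continuous_legendreP d k
  rw [map_measureReal_apply hm] at h
  · refine (measureReal_mono fun v hv => ?_).trans h
    -- At `u` the two ridge functions are `β` and `β P(t)`, where `t` is the inner product of the
    -- centres; at the reflected point they are `β P(t)` and `β P(2 t² - 1)`.
    have h1 := hv u
    have h2 := (abs_le.1 (hv (sphereReflection u v))).2
    simp only [ridge, inner_sphereReflection_left, inner_sphereReflection_right,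
      real_inner_self_eq_norm_sq, norm_eq_of_mem_sphere, one_pow, legendreP_apply_one hd] at h1 h2
    have h1 := (abs_le.1 h1).2
    constructor <;> nlinarith
  · exact (measurableSet_le measurable_const hc.measurable).inter
      (measurableSet_le (hc.measurable.sub (hc.measurable.comp (by fun_prop))) measurable_const)

end Sphere

/-! ### The success event under both laws, and the conclusion. -/

lemma integral_prod_prod_comm {U Ω Y : Type*} [MeasurableSpace U] [MeasurableSpace Ω]
    [MeasurableSpace Y] (σ : Measure U) (μ : Measure Ω) (ν : Measure Y) [IsProbabilityMeasure σ]
    [IsProbabilityMeasure μ] [IsProbabilityMeasure ν] {f : (U × Ω) × Y → ℝ}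
    (hf : Integrable f ((σ.prod μ).prod ν)) :
    ∫ p, f p ∂(σ.prod μ).prod ν = ∫ q, ∫ u, f ((u, q.1), q.2) ∂σ ∂μ.prod ν := by
  have h := (measurePreserving_prodAssoc σ μ ν).symm
  rw [← h.integral_comp', integral_prod_symm]
  · rfl
  · exact h.integrable_comp_of_integrable hf

lemma prod_prod_measure_le {U Ω Y : Type*} [MeasurableSpace U] [MeasurableSpace Ω]
    [MeasurableSpace Y] (σ : Measure U) (μ : Measure Ω) (ν : Measure Y) [IsProbabilityMeasure σ]
    [IsProbabilityMeasure μ] [IsProbabilityMeasure ν] {S : Set ((U × Ω) × Y)}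
    (hS : MeasurableSet S) {c : ℝ} (hc : 0 ≤ c)
    (h : ∀ ω y, σ.real {u | ((u, ω), y) ∈ S} ≤ c) :
    ((σ.prod μ).prod ν).real S ≤ c := by
  have e := (measurePreserving_prodAssoc σ μ ν).symm
  have hS' := e.measurable hS
  rw [measureReal_def, ← e.measure_preimage hS.nullMeasurableSet, Measure.prod_apply_symm hS']
  refine ENNReal.toReal_le_of_le_ofReal hc ?_
  calc _ ≤ ∫⁻ _, ENNReal.ofReal c ∂μ.prod ν := by
        refine lintegral_mono fun q => ?_
        rw [← ENNReal.ofReal_toReal (measure_ne_top σ _)]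
        exact ENNReal.ofReal_le_ofReal (h q.1 q.2)
    _ = _ := by simp

lemma half_le_prod_prod_measure {U Ω Y : Type*} [MeasurableSpace U] [MeasurableSpace Ω]
    [MeasurableSpace Y] (σ : Measure U) (μ : Measure Ω) (ν : Measure Y) [IsProbabilityMeasure σ]
    [IsProbabilityMeasure μ] [IsProbabilityMeasure ν] {S : Set ((U × Ω) × Y)}
    (hS : MeasurableSet S) (h : ∀ u, 1 / 2 ≤ (μ.prod ν) {q | ((u, q.1), q.2) ∈ S}) :
    1 / 2 ≤ ((σ.prod μ).prod ν).real S := by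
  have e := (measurePreserving_prodAssoc σ μ ν).symm
  have hS' := e.measurable hS
  have h1 : (1 / 2 : ℝ≥0∞) ≤ ((σ.prod μ).prod ν) S := by
    rw [← e.measure_preimage hS.nullMeasurableSet, Measure.prod_apply hS']
    calc (1 / 2 : ℝ≥0∞) = ∫⁻ _, (1 / 2 : ℝ≥0∞) ∂σ := by simp
      _ ≤ _ := lintegral_mono h
  simpa [measureReal_def] using ENNReal.toReal_mono (measure_ne_top _ _) h1

lemma abs_sub_le_of_supDist_le {d : ℕ} {g f : UnitSphere d → ℝ} {r : ℝ} (hr : 0 ≤ r)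
    (h : supDist g f ≤ ENNReal.ofReal r) (x : UnitSphere d) : |g x - f x| ≤ r := by
  have h1 := (le_iSup (fun x => ‖g x - f x‖ₑ) x).trans h
  rwa [Real.enorm_eq_ofReal_abs, ENNReal.ofReal_le_ofReal_iff hr] at h1

namespace QueryAlgorithm

variable {d n : ℕ} {Ω : Type*} [MeasurableSpace Ω]

/-- The centres, seeds and responses for which the output is close to the ridge function on the
set `D`. -/
def closeOn (A : QueryAlgorithm d n Ω) (k : ℕ) (β : ℝ) (D : Set (UnitSphere d)) :
    Set ((UnitSphere d × Ω) × (Fin n → ℝ)) :=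
  {p | ∀ x ∈ D, |A.output p.1.2 p.2 x - ridge k d β p.1.1 x| ≤ β / 4}

/-- The output is measurable only pointwise, hence the restriction to a countable set of points. -/
lemma measurableSet_closeOn (A : QueryAlgorithm d n Ω) (k : ℕ) (β : ℝ) {D : Set (UnitSphere d)}
    (hD : D.Countable) : MeasurableSet (A.closeOn k β D) := by
  have h1 (x : UnitSphere d) : Measurable fun p : (UnitSphere d × Ω) × (Fin n → ℝ) =>
      A.output p.1.2 p.2 x :=
    (A.measurable_output x).comp (measurable_fst.snd.prodMk measurable_snd)
  have h2 (x : UnitSphere d) : Measurable fun p : (UnitSphere d × Ω) × (Fin n → ℝ) =>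
      ridge k d β p.1.1 x := by
    have h : Measurable fun u => ridge k d β u x :=
      ((continuous_ridge k β).comp (continuous_id.prodMk continuous_const)).measurable
    exact h.comp measurable_fst.fst
  have h3 : A.closeOn k β D = ⋂ x ∈ D, {p | |A.output p.1.2 p.2 x - ridge k d β p.1.1 x| ≤ β / 4} := by
    ext p; simp [closeOn]
  rw [h3]
  exact MeasurableSet.biInter hD fun x _ =>
    measurableSet_le ((h1 x).sub (h2 x)).abs measurable_const

/-- All centres fitting one output are close to any one of them, by the triangle inequality on `D`.
Density suffices because ridge functions are continuous, whatever the output is. -/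
lemma measureReal_closeOn_le (hd : 3 ≤ d) {k : ℕ} (hk : 4 ≤ k) {β : ℝ} (hβ : 0 < β)
    {σ : Measure (UnitSphere d)} [IsProbabilityMeasure σ]
    (hσ : ∀ x : UnitSphere d, IsSphereCoordinateLaw d (σ.map fun u : UnitSphere d =>
      inner ℝ (x : EuclideanSpace ℝ (Fin d)) (u : EuclideanSpace ℝ (Fin d))))
    (A : QueryAlgorithm d n Ω) {D : Set (UnitSphere d)} (hD : Dense D) (ω : Ω) (y : Fin n → ℝ) :
    σ.real {u | ((u, ω), y) ∈ A.closeOn k β D} ≤ 6 / 125 := by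
  rcases Set.eq_empty_or_nonempty {u | ((u, ω), y) ∈ A.closeOn k β D} with he | ⟨u, hu⟩
  · rw [he]
    norm_num
  · refine (measureReal_mono fun v hv => ?_).trans (measureReal_ridge_close_le hd hk hβ hσ u)
    have hc (u : UnitSphere d) : Continuous fun x => ridge k d β u x :=
      (continuous_ridge k β).comp (continuous_const.prodMk continuous_id)
    have hcl : IsClosed {x | |ridge k d β u x - ridge k d β v x| ≤ β / 2} :=
      isClosed_le ((hc u).sub (hc v)).abs continuous_const
    have hsub : D ⊆ {x | |ridge k d β u x - ridge k d β v x| ≤ β / 2} := by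
      intro x hx
      have h1 := abs_le.1 (hu x hx)
      have h2 := abs_le.1 (hv x hx)
      simp only at h1 h2
      change |ridge k d β u x - ridge k d β v x| ≤ β / 2
      exact abs_le.2 ⟨by linarith, by linarith⟩
    exact fun x => hcl.closure_subset_iff.2 hsub (hD x)

/-- The mean energy observed in one round under pure noise. -/
lemma integral_ridge_query_sq (hd : 3 ≤ d) {k : ℕ} (hk : 1 ≤ k) (β : ℝ)
    {σ : Measure (UnitSphere d)} [IsProbabilityMeasure σ]
    (hσ : ∀ x : UnitSphere d, IsSphereCoordinateLaw d (σ.map fun u : UnitSphere d =>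
      inner ℝ (x : EuclideanSpace ℝ (Fin d)) (u : EuclideanSpace ℝ (Fin d))))
    (μ : Measure Ω) [IsProbabilityMeasure μ] (A : QueryAlgorithm d n Ω) (i : ℕ) :
    ∫ p : (UnitSphere d × Ω) × (Fin i → ℝ), (ridge k d β p.1.1 (A.query i p.1.2 p.2)) ^ 2
        ∂(σ.prod μ).prod (Measure.pi fun _ : Fin i => gaussianReal 0 1)
      = β ^ 2 * (harmonicDim k d : ℝ)⁻¹ := by
  obtain ⟨M, hM⟩ := exists_abs_ridge_le (d := d) k β
  have hx (x : UnitSphere d) : ∫ u, (ridge k d β u x) ^ 2 ∂σ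
      = β ^ 2 * (harmonicDim k d : ℝ)⁻¹ := by
    have h1 := (hσ x).integral_legendreP_sq_mul hd hk
    have hm : Measurable fun u : UnitSphere d =>
        (inner ℝ (x : EuclideanSpace ℝ (Fin d)) (u : EuclideanSpace ℝ (Fin d)) : ℝ) := by fun_prop
    have hP : Continuous fun t => legendreP d k t ^ 2 := (continuous_legendreP d k).pow 2
    rw [integral_map hm.aemeasurable hP.aestronglyMeasurable] at h1
    simp only [ridge, mul_pow, integral_const_mul]
    rw [eq_inv_of_mul_eq_one_left h1]
  have hmeas := A.measurable_drift (F := ridge k d β) (continuous_ridge k β).measurable i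
  -- Under pure noise the query does not depend on the centre, so the centre is integrated first, at
  -- a fixed query point.
  rw [integral_prod_prod_comm]
  · simp [hx]
  · refine integrable_of_mem_Icc (a := 0) (b := M ^ 2) (hmeas.pow_const 2)
      fun p => ⟨sq_nonneg _, ?_⟩
    rw [← sq_abs]
    exact pow_le_pow_left₀ (abs_nonneg _) (hM _ _) 2

end QueryAlgorithm

theorem lemma6 (d k : ℕ) (hd : 3 ≤ d) (hk : 4 ≤ k) (β : ℝ) (hβ0 : 0 < β) (hβ1 : β < 1)
    {Ω : Type*} [MeasurableSpace Ω] (μ : Measure Ω) [IsProbabilityMeasure μ]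
    (n : ℕ) (A : QueryAlgorithm d n Ω)
    (hn : (n : ℝ) < (harmonicDim k d : ℝ) * (β ^ 2)⁻¹) :
    ∃ f ∈ hypothesisClass k d β, A.successProb μ f (β / 4) ≤ 1 / 2 := by
  by_contra! hcon
  obtain ⟨σ, hσ, hlaw⟩ := exists_probabilityMeasure_sphere_coordinateLaw (show 2 ≤ d by omega)
  obtain ⟨M, hM⟩ := exists_abs_ridge_le (d := d) k β
  have hF : Measurable (Function.uncurry (ridge k d β)) := (continuous_ridge k β).measurable
  obtain ⟨D, hDc, hDd⟩ := TopologicalSpace.exists_countable_dense (UnitSphere d)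
  set γ : Measure (Fin n → ℝ) := Measure.pi fun _ : Fin n => gaussianReal 0 1
  set S := A.closeOn k β D
  have hS : MeasurableSet S := A.measurableSet_closeOn k β hDc
  set T : (UnitSphere d × Ω) × (Fin n → ℝ) → (UnitSphere d × Ω) × (Fin n → ℝ) :=
    fun p => (p.1, A.responses (ridge k d β p.1.1) p.1.2 n p.2) with hT
  have hTm : Measurable T := measurable_fst.prodMk (A.measurable_responses hF n)
  have hq : ((σ.prod μ).prod γ).real S ≤ 6 / 125 :=
    prod_prod_measure_le σ μ γ hS (by norm_num)
      (A.measureReal_closeOn_le hd hk hβ0 hlaw hDd)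
  have hp : 1 / 2 ≤ ((σ.prod μ).prod γ).real (T ⁻¹' S) := by
    refine half_le_prod_prod_measure σ μ γ (hTm hS) fun u => ?_
    -- The success event itself may fail to be measurable; monotonicity of the outer measure is
    -- enough.
    refine (hcon _ ⟨u, rfl⟩).le.trans (measure_mono fun q hq' x _ => ?_)
    exact abs_sub_le_of_supDist_le (by linarith) hq' x
  have henergy := A.integral_ridge_query_sq hd (show 1 ≤ k by omega) β hlaw μ
  -- The values 1/10 on `S` and 19/10 off it are symmetric about 1, so true probability at least 1/2
  -- for `S` forces mean at most 1.
  set φ : (UnitSphere d × Ω) × (Fin n → ℝ) → ℝ :=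
    fun p => 19 / 10 - S.indicator (fun _ => 9 / 5) p with hφdef
  have hφ : Measurable φ := measurable_const.sub (measurable_const.indicator hS)
  have hφab : ∀ p, φ p ∈ Set.Icc (1 / 10 : ℝ) (19 / 10) := by
    intro p
    by_cases h : p ∈ S <;> simp [hφdef, h] <;> norm_num
  have key := A.integral_log_le_log_integral_responses hF hM (σ.prod μ) n hφ (by norm_num) hφab
  have hlogφ : (fun p => Real.log (φ p)) = fun p => Real.log (19 / 10)
      - S.indicator (fun _ => Real.log (19 / 10) - Real.log (1 / 10)) p := by
    ext p
    by_cases h : p ∈ S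
    · simp only [hφdef, Set.indicator_of_mem h]
      norm_num
    · simp [hφdef, h]
  have hleft : 1 / 2 ≤ ∫ p, Real.log (φ p) ∂(σ.prod μ).prod γ := by
    rw [hlogφ, integral_sub (integrable_const _) ((integrable_const _).indicator hS),
      integral_indicator_const _ hS]
    have hpos : 0 ≤ Real.log (19 / 10) - Real.log (1 / 10) :=
      sub_nonneg.2 (Real.log_le_log (by norm_num) (by norm_num))
    have := half_le_log_combination
    have := mul_le_mul_of_nonneg_right hq hpos
    simp only [integral_const, probReal_univ, smul_eq_mul, one_mul]
    linarith
  have hright : ∫ p, φ (T p) ∂(σ.prod μ).prod γ ≤ 1 := by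
    have e : (fun p => φ (T p)) = fun p => 19 / 10 - (T ⁻¹' S).indicator (fun _ => 9 / 5) p := rfl
    rw [e, integral_sub (integrable_const _) ((integrable_const _).indicator (hTm hS)),
      integral_indicator_const _ (hTm hS)]
    simp only [integral_const, probReal_univ, smul_eq_mul, one_mul]
    linarith
  have hright0 : 0 ≤ ∫ p, φ (T p) ∂(σ.prod μ).prod γ :=
    integral_nonneg fun p => le_trans (by norm_num) (hφab _).1
  simp only [henergy, Finset.sum_const, Finset.card_range, nsmul_eq_mul] at key
  have hlog := Real.log_nonpos hright0 hright
  -- Positivity follows from `hn`, since `n` is nonnegative.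
  have hN : (0 : ℝ) < harmonicDim k d := by
    by_contra! h
    have h0 : (0 : ℝ) ≤ n := n.cast_nonneg
    have h1 : (0 : ℝ) < (β ^ 2)⁻¹ := by positivity
    nlinarith
  have hfin : (n : ℝ) * (β ^ 2 * (harmonicDim k d : ℝ)⁻¹) < 1 := by
    rw [← div_eq_mul_inv, lt_div_iff₀ (by positivity)] at hn
    rw [← mul_assoc, ← div_eq_mul_inv, div_lt_one hN]
    exact hn
  simp only [hT] at hlog
  linarith
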